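/- **Setting.** Let $T$ be a locally compact Hausdorff space and let $\tau:T\to T$ be a local homeomorphism that is proper (inverse images of compact sets are compact). Put $A=C_0(T)$, let $\alpha:A\to A$ be $\alpha(f)=f\circ\tau$, and let $L:A\to A$ be the transfer operator $$L(f)(t)=\frac1{|\tau^{-1}(t)|}\sum_{\tau(s)=t}f(s),\qquad L(f)(t)=0\text{ if }\tau^{-1}(t)=\emptyset .$$ **The bimodule.** Let $M_L$ be the Hilbert $A$-bimodule obtained by completing $A$ (via $q:A\to M_L$) for the pre-inner product $\langle m,n\rangle=L(m^*n)$, with right action $q(m)\cdot a=q(m\alpha(a))$ and left action $\phi(a)q(m)=q(am)$. Let $\mathcal K(M_L)=\overline{\mathrm{span}}\{\Theta_{x,y}\}$, where $\Theta_{x,y}(z)=x\cdot\langle y,z\rangle$. Put $J(M_L)=\phi^{-1}(\mathcal K(M_L))$ and $K_\alpha=\overline{\mathrm{span}}(A\alpha(A)A)\cap J(M_L)$. **Toeplitz and Cuntz–Pimsner algebras.** A Toeplitz representation $(\psi,\pi)$ of $M_L$ in a $C^*$-algebra $B$ is a linear map $\psi:M_L\to B$ and a $*$-homomorphism $\pi:A\to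 B$ with $\psi(x\cdot a)=\psi(x)\pi(a)$, $\psi(x)^*\psi(y)=\pi(\langle x,y\rangle)$ and $\psi(\phi(a)x)=\pi(a)\psi(x)$. Let $(\psi,\pi)^{(1)}:\mathcal K(M_L)\to B$ be the continuous linear map with $\Theta_{x,y}\mapsto\psi(x)\psi(y)^*$. The representation is coisometric on $J(M_L)$ if $(\psi,\pi)^{(1)}(\phi(a))=\pi(a)$ for $a\in J(M_L)$. Pimsner's Cuntz–Pimsner algebra $(\mathcal O(M_L),k_{M_L},k_A)$ is the $C^*$-algebra generated by a universal Toeplitz representation of $M_L$ that is coisometric on $J(M_L)$. **The Exel crossed product.** A Toeplitz-covariant representation of $(A,\alpha,L)$ in a $C^*$-algebra $B$ is a nondegenerate $*$-homomorphism $\pi:A\to B$ and an element $V$ of the multiplier algebra $M(B)$ with $V\pi(a)=\pi(\alpha(a))V$ and $V^*\pi(a)V=\pi(L(a))$. The Toeplitz crossed product $\mathcal T(A,\alpha,L)$ is the $C^*$-algebra generated (by $i(A)\cup i(A)S$) by a universal Toeplitz-covariant representation $(i,S)$. A redundancy is a pair $(i(a),k)$ with $k\in\overline{\mathrm{span}}(i(A)SS^*i(A))$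 and $i(a)i(b)S=k\,i(b)S$ for all $b\in A$. The crossed product $A\rtimes_{\alpha,L}\mathbb N$ is the quotient of $\mathcal T(A,\alpha,L)$, with quotient map $Q$, by the closed two-sided ideal generated by the elements $i(a)-k$ for which $(i(a),k)$ is a redundancy and $a\in\overline{\mathrm{span}}(A\alpha(A)A)$. **Corollary 4.2.** 1. $\phi(f)\in\mathcal K(M_L)$ for every $f\in C_0(T)$, and $K_\alpha=C_0(T)$. 2. A Toeplitz crossed product $\mathcal T(C_0(T),\alpha,L)$ exists. For every Toeplitz crossed product with its universal representation $(i,S)$, there is a linear map $\psi_S:M_L\to\mathcal T(C_0(T),\alpha,L)$ such that $\psi_S(q(m))=i(m)S$ for all $m\in C_0(T)$ and $(\psi_S,i)$ is a Toeplitz representation of $M_L$. Moreover $\bigl(C_0(T)\rtimes_{\alpha,L}\mathbb N,\;k_{M_L},\;k_A\bigr)$, with $k_{M_L}=Q\circ\psi_S$ and $k_A=Q\circ i$, is Pimsner's Cuntz–Pimsner algebra $(\mathcal O(M_L),k_{M_L},k_A)$. -/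

import Mathlib

open scoped MultiplierAlgebra ZeroAtInfty

universe u

/-- A closed two-sided ideal of a C⋆-algebra. -/
structure ClosedIdeal (B : Type u) [NonUnitalCStarAlgebra B] extends Submodule ℂ B where
  mul_mem_left : ∀ (b : B) {x : B}, x ∈ carrier → b * x ∈ carrier
  mul_mem_right : ∀ (b : B) {x : B}, x ∈ carrier → x * b ∈ carrier
  isClosed : IsClosed carrier

namespace ClosedIdeal

variable {B : Type u} [NonUnitalCStarAlgebra B]

/-- The closed two-sided ideal generated by a set: the intersection of all those containing it. -/
def generated (s : Set B) : ClosedIdeal B where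
  carrier := {x | ∀ J : ClosedIdeal B, s ⊆ J.carrier → x ∈ J.carrier}
  add_mem' hx hy J hJ := J.add_mem' (hx J hJ) (hy J hJ)
  zero_mem' J _ := J.zero_mem'
  smul_mem' c _ hx J hJ := J.smul_mem' c (hx J hJ)
  mul_mem_left b _ hx J hJ := J.mul_mem_left b (hx J hJ)
  mul_mem_right b _ hx J hJ := J.mul_mem_right b (hx J hJ)
  isClosed := by
    have h : {x : B | ∀ J : ClosedIdeal B, s ⊆ J.carrier → x ∈ J.carrier} =
        ⋂ (J : ClosedIdeal B) (_ : s ⊆ J.carrier), J.carrier := by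
      ext x; simp
    rw [h]
    exact isClosed_iInter fun J => isClosed_iInter fun _ => J.isClosed

/-- The quotient `B ⧸ I`, with the quotient norm. -/
abbrev Quot (I : ClosedIdeal B) : Type u := B ⧸ I.toSubmodule

instance (I : ClosedIdeal B) : IsClosed (I.toSubmodule : Set B) := I.isClosed

/-- The quotient map on elements. -/
abbrev proj (I : ClosedIdeal B) (b : B) : I.Quot := Submodule.Quotient.mk b

variable (I : ClosedIdeal B)

/-- The C⋆-subalgebra of those `x` for which both `x` and `star x` lie in the ideal. -/
def toStarSubalgebra : NonUnitalStarSubalgebra ℂ B where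
  carrier := {x | x ∈ I.carrier ∧ star x ∈ I.carrier}
  add_mem' ha hb := ⟨I.add_mem' ha.1 hb.1, by rw [star_add]; exact I.add_mem' ha.2 hb.2⟩
  zero_mem' := ⟨I.zero_mem', by rw [star_zero]; exact I.zero_mem'⟩
  smul_mem' c _ hx := ⟨I.smul_mem' c hx.1, by rw [star_smul]; exact I.smul_mem' _ hx.2⟩
  mul_mem' ha hb := ⟨I.mul_mem_left _ hb.1, by rw [star_mul]; exact I.mul_mem_left _ ha.2⟩
  star_mem' h := ⟨h.2, by rw [star_star]; exact h.1⟩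

theorem exists_approx (x : B) (hx : x ∈ I.carrier) (hx' : star x ∈ I.carrier) {ε : ℝ} (hε : 0 < ε) :
    ∃ e ∈ I.carrier, ‖x - x * e‖ < ε ∧ (∀ b : B, ‖b - b * e‖ ≤ ‖b‖) ∧
      ∀ b : B, ‖b - b * e‖ ^ 2 ≤ ‖star b * b - star b * b * e‖ := by
  let _ : IsClosed (I.toStarSubalgebra : Set B) :=
    I.isClosed.inter (I.isClosed.preimage continuous_star)
  let _ : NonUnitalCStarAlgebra I.toStarSubalgebra :=
    NonUnitalStarSubalgebra.nonUnitalCStarAlgebra I.toStarSubalgebra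
  let _ := CStarAlgebra.spectralOrder I.toStarSubalgebra
  have := CStarAlgebra.spectralOrderedRing I.toStarSubalgebra
  have hu := CStarAlgebra.increasingApproximateUnit I.toStarSubalgebra
  have := hu.neBot
  have h1 := (Metric.tendsto_nhds.mp (hu.tendsto_mul_left ⟨x, hx, hx'⟩)) ε hε
  obtain ⟨e, he1, he2, he3⟩ := (h1.and (hu.eventually_nonneg.and hu.eventually_norm)).exists
  obtain ⟨y, hy⟩ := CStarAlgebra.nonneg_iff_eq_star_mul_self.mp he2
  let _ := CStarAlgebra.spectralOrder B
  have := CStarAlgebra.spectralOrderedRing B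
  have hpos : (0 : B) ≤ (e : B) := by
    rw [hy]
    exact star_mul_self_nonneg (y : B)
  have hnorm : ‖(e : B)‖ ≤ 1 := he3
  have hU0 : (0 : Unitization ℂ B) ≤ ((e : B) : Unitization ℂ B) :=
    Unitization.inr_nonneg_iff.mpr hpos
  have hU : ((e : B) : Unitization ℂ B) ∈ Set.Icc (0 : Unitization ℂ B) 1 := by
    rw [CStarAlgebra.mem_Icc_iff_norm_le_one]
    exact ⟨hU0, by rwa [Unitization.norm_inr]⟩
  have hV : ‖(1 : Unitization ℂ B) - ((e : B) : Unitization ℂ B)‖ ≤ 1 :=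
    (CStarAlgebra.mem_Icc_iff_norm_le_one.mp (Set.sub_mem_Icc_zero_iff_right.mpr hU)).2
  have hsa : star ((1 : Unitization ℂ B) - ((e : B) : Unitization ℂ B)) =
      1 - ((e : B) : Unitization ℂ B) := by
    rw [star_sub, star_one, (IsSelfAdjoint.of_nonneg hU0).star_eq]
  have hmul : ∀ b : B, ((b - b * (e : B) : B) : Unitization ℂ B) =
      (b : Unitization ℂ B) * (1 - ((e : B) : Unitization ℂ B)) := by
    intro b
    rw [mul_sub, mul_one, Unitization.inr_sub, Unitization.inr_mul]
  refine ⟨e, e.2.1, ?_, ?_, ?_⟩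
  · have := he1
    rw [dist_eq_norm, ← norm_neg, neg_sub] at this
    exact this
  · intro b
    rw [← Unitization.norm_inr (𝕜 := ℂ), hmul, ← Unitization.norm_inr (𝕜 := ℂ) (a := b)]
    exact (norm_mul_le _ _).trans (mul_le_of_le_one_right (norm_nonneg _) hV)
  · intro b
    rw [← Unitization.norm_inr (𝕜 := ℂ), hmul, sq, ← CStarRing.norm_star_mul_self,
      ← Unitization.norm_inr (𝕜 := ℂ) (a := star b * b - star b * b * (e : B)), hmul, star_mul, hsa,
      Unitization.inr_mul, Unitization.inr_star]
    rw [mul_assoc, ← mul_assoc (star _)]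
    exact (norm_mul_le _ _).trans (mul_le_of_le_one_left (norm_nonneg _) hV)

/-- Closed two-sided ideals of C⋆-algebras are self-adjoint. -/
theorem star_mem {x : B} (hx : x ∈ I.carrier) : star x ∈ I.carrier := by
  have hcl : star x ∈ closure I.carrier := by
    refine Metric.mem_closure_iff.mpr fun ε hε => ?_
    have h0 : x * star x ∈ I.carrier := I.mul_mem_right _ hx
    obtain ⟨e, he, h1, _, h3⟩ := I.exists_approx (x * star x) h0
      (by rw [star_mul, star_star]; exact h0) (pow_pos hε 2)
    refine ⟨star x * e, I.mul_mem_left _ he, ?_⟩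
    rw [dist_eq_norm]
    have h4 := h3 (star x)
    rw [star_star] at h4
    exact lt_of_pow_lt_pow_left₀ 2 hε.le (h4.trans_lt h1)
  rwa [I.isClosed.closure_eq] at hcl

theorem proj_eq_proj {a b : B} : I.proj a = I.proj b ↔ a - b ∈ I.carrier :=
  Submodule.Quotient.eq _

theorem proj_surjective : Function.Surjective I.proj := Submodule.Quotient.mk_surjective _

instance : Mul I.Quot where
  mul := Quotient.map₂ (· * ·) (by
    intro a a' ha b b' hb
    have ha' : a - a' ∈ I.carrier := (Submodule.quotientRel_def _).mp ha
    have hb' : b - b' ∈ I.carrier := (Submodule.quotientRel_def _).mp hb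
    refine (Submodule.quotientRel_def _).mpr ?_
    have h : a * b - a' * b' = (a - a') * b + a' * (b - b') := by
      rw [sub_mul, mul_sub]; abel
    show a * b - a' * b' ∈ I.toSubmodule
    rw [h]
    exact I.toSubmodule.add_mem (I.mul_mem_right b ha') (I.mul_mem_left a' hb'))

instance : Star I.Quot where
  star := Quotient.map star (by
    intro a a' ha
    have ha' : a - a' ∈ I.carrier := (Submodule.quotientRel_def _).mp ha
    refine (Submodule.quotientRel_def _).mpr ?_
    rw [← star_sub]
    exact I.star_mem ha')

theorem proj_mul (a b : B) : I.proj (a * b) = I.proj a * I.proj b := rfl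

theorem proj_star (a : B) : I.proj (star a) = star (I.proj a) := rfl

theorem proj_add (a b : B) : I.proj (a + b) = I.proj a + I.proj b := rfl

theorem proj_smul (c : ℂ) (a : B) : I.proj (c • a) = c • I.proj a := rfl

theorem norm_proj_add_le (a x : B) (hx : x ∈ I.carrier) : ‖I.proj a‖ ≤ ‖a + x‖ := by
  have h : I.proj a = I.proj (a + x) := by
    rw [proj_eq_proj]
    have : a - (a + x) = -x := by abel
    rw [this]
    exact I.toSubmodule.neg_mem hx
  rw [h]
  exact Submodule.Quotient.norm_mk_le _ _

theorem exists_norm_lt (q : I.Quot) {ε : ℝ} (hε : 0 < ε) : ∃ b : B, I.proj b = q ∧ ‖b‖ < ‖q‖ + ε :=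
  Submodule.Quotient.norm_mk_lt q hε

instance : NonUnitalRing I.Quot where
  left_distrib a b c := by
    obtain ⟨a, rfl⟩ := I.proj_surjective a
    obtain ⟨b, rfl⟩ := I.proj_surjective b
    obtain ⟨c, rfl⟩ := I.proj_surjective c
    exact congrArg I.proj (mul_add a b c)
  right_distrib a b c := by
    obtain ⟨a, rfl⟩ := I.proj_surjective a
    obtain ⟨b, rfl⟩ := I.proj_surjective b
    obtain ⟨c, rfl⟩ := I.proj_surjective c
    exact congrArg I.proj (add_mul a b c)
  zero_mul a := by
    obtain ⟨a, rfl⟩ := I.proj_surjective a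
    exact congrArg I.proj (zero_mul a)
  mul_zero a := by
    obtain ⟨a, rfl⟩ := I.proj_surjective a
    exact congrArg I.proj (mul_zero a)
  mul_assoc a b c := by
    obtain ⟨a, rfl⟩ := I.proj_surjective a
    obtain ⟨b, rfl⟩ := I.proj_surjective b
    obtain ⟨c, rfl⟩ := I.proj_surjective c
    exact congrArg I.proj (mul_assoc a b c)

instance : StarRing I.Quot where
  star_involutive a := by
    obtain ⟨a, rfl⟩ := I.proj_surjective a
    exact congrArg I.proj (star_star a)
  star_mul a b := by
    obtain ⟨a, rfl⟩ := I.proj_surjective a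
    obtain ⟨b, rfl⟩ := I.proj_surjective b
    exact congrArg I.proj (star_mul a b)
  star_add a b := by
    obtain ⟨a, rfl⟩ := I.proj_surjective a
    obtain ⟨b, rfl⟩ := I.proj_surjective b
    exact congrArg I.proj (star_add a b)

theorem norm_mul_self_le_quot (q : I.Quot) : ‖q‖ * ‖q‖ ≤ ‖star q * q‖ := by
  obtain ⟨a, rfl⟩ := I.proj_surjective q
  refine le_of_forall_pos_le_add fun ε hε => ?_
  obtain ⟨b, hb, hb'⟩ := I.exists_norm_lt (star (I.proj a) * I.proj a) (half_pos hε)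
  have hx : star a * a - b ∈ I.carrier := by
    rw [← proj_eq_proj, hb, proj_mul, proj_star]
  obtain ⟨e, he, h1, h2, h3⟩ := I.exists_approx _ hx (I.star_mem hx) (half_pos hε)
  have h4 : ‖I.proj a‖ ≤ ‖a - a * e‖ := by
    rw [sub_eq_add_neg]
    exact I.norm_proj_add_le _ _ (I.toSubmodule.neg_mem (I.mul_mem_left a he))
  have h5 : star a * a - star a * a * e =
      (b - b * e) + ((star a * a - b) - (star a * a - b) * e) := by
    rw [sub_mul]; abel
  calc ‖I.proj a‖ * ‖I.proj a‖ ≤ ‖a - a * e‖ ^ 2 := by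
        rw [sq]; exact mul_self_le_mul_self (norm_nonneg _) h4
    _ ≤ ‖star a * a - star a * a * e‖ := h3 a
    _ ≤ ‖b - b * e‖ + ‖(star a * a - b) - (star a * a - b) * e‖ := by
        rw [h5]; exact norm_add_le _ _
    _ ≤ ‖b‖ + ε / 2 := add_le_add (h2 b) h1.le
    _ ≤ ‖star (I.proj a) * I.proj a‖ + ε := by linarith

theorem norm_mul_le_quot (p q : I.Quot) : ‖p * q‖ ≤ ‖p‖ * ‖q‖ := by
  have key : ∀ δ : ℝ, 0 < δ → ‖p * q‖ ≤ (‖p‖ + δ) * (‖q‖ + δ) := by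
    intro δ hδ
    obtain ⟨a, rfl, ha⟩ := I.exists_norm_lt p hδ
    obtain ⟨b, rfl, hb⟩ := I.exists_norm_lt q hδ
    rw [← proj_mul]
    calc ‖I.proj (a * b)‖ ≤ ‖a * b‖ := Submodule.Quotient.norm_mk_le _ _
      _ ≤ ‖a‖ * ‖b‖ := norm_mul_le _ _
      _ ≤ _ := mul_le_mul ha.le hb.le (norm_nonneg _) (by positivity)
  have hlim : Filter.Tendsto (fun δ : ℝ => (‖p‖ + δ) * (‖q‖ + δ)) (nhdsWithin 0 (Set.Ioi 0))
      (nhds ((‖p‖ + 0) * (‖q‖ + 0))) := by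
    apply Filter.Tendsto.mono_left _ nhdsWithin_le_nhds
    exact Continuous.tendsto (by fun_prop) 0
  have := ge_of_tendsto hlim (Filter.eventually_of_mem self_mem_nhdsWithin fun δ hδ => key δ hδ)
  simpa using this

/-- The quotient of a C⋆-algebra by a closed ideal is a C⋆-algebra. -/
noncomputable instance : NonUnitalCStarAlgebra I.Quot where
  __ := (inferInstance : NonUnitalRing I.Quot)
  __ := (inferInstance : NormedAddCommGroup I.Quot)
  __ := (inferInstance : StarRing I.Quot)
  __ := (inferInstance : NormedSpace ℂ I.Quot)
  __ := (inferInstance : CompleteSpace I.Quot)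
  norm_mul_le := I.norm_mul_le_quot
  norm_mul_self_le := I.norm_mul_self_le_quot
  smul_assoc c a b := by
    obtain ⟨a, rfl⟩ := I.proj_surjective a
    obtain ⟨b, rfl⟩ := I.proj_surjective b
    exact congrArg I.proj (smul_mul_assoc c a b)
  smul_comm c a b := by
    obtain ⟨a, rfl⟩ := I.proj_surjective a
    obtain ⟨b, rfl⟩ := I.proj_surjective b
    exact congrArg I.proj (mul_smul_comm c a b).symm
  star_smul c a := by
    obtain ⟨a, rfl⟩ := I.proj_surjective a
    exact congrArg I.proj (star_smul c a)

/-- The quotient map `B → B ⧸ I` as a `*`-homomorphism. -/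
noncomputable def projHom : B →⋆ₙₐ[ℂ] I.Quot where
  toFun := I.proj
  map_smul' _ _ := rfl
  map_zero' := rfl
  map_add' _ _ := rfl
  map_mul' _ _ := rfl
  map_star' _ := rfl

end ClosedIdeal

/-- A classical system `(T, τ)`: a local homeomorphism `τ : T → T` that is proper in the sense
that inverse images of compact sets are compact. -/
structure ClassicalSystem (T : Type u) [TopologicalSpace T] where
  toFun : T → T
  isLocalHomeomorph : IsLocalHomeomorph toFun
  isCompact_preimage : ∀ K : Set T, IsCompact K → IsCompact (toFun ⁻¹' K)

namespace ClassicalSystem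

variable {T : Type u} [TopologicalSpace T] (S : ClassicalSystem T)

/-- `τ` as a map under which inverse images of neighbourhoods of infinity are such. -/
def cocompactMap : CocompactMap T T where
  toFun := S.toFun
  continuous_toFun := S.isLocalHomeomorph.continuous
  cocompact_tendsto' := CocompactMap.tendsto_of_forall_preimage S.isCompact_preimage

/-- The endomorphism `α : f ↦ f ∘ τ` of `C₀(T)`. -/
noncomputable def α : C₀(T, ℂ) →⋆ₙₐ[ℂ] C₀(T, ℂ) where
  __ := ZeroAtInftyContinuousMap.compNonUnitalAlgHom S.cocompactMap
  map_star' _ := rfl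

@[simp]
theorem α_apply (f : C₀(T, ℂ)) (t : T) : S.α f t = f (S.toFun t) := rfl

/-- The average `|τ⁻¹(t)|⁻¹ ∑_{τ(s) = t} f(s)` of `f` over the fibre of `τ` at `t`
(which is `0` when the fibre is empty). -/
noncomputable def avg (f : T → ℂ) (t : T) : ℂ :=
  ((S.toFun ⁻¹' {t}).ncard : ℂ)⁻¹ * ∑ᶠ s ∈ S.toFun ⁻¹' {t}, f s

theorem isDiscrete_fiber (t : T) : IsDiscrete (S.toFun ⁻¹' {t}) :=
  IsDiscrete.of_openPartialHomeomorph S.toFun subset_rfl fun e _ => by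
    obtain ⟨φ, h, h'⟩ := S.isLocalHomeomorph e
    exact ⟨φ, h, h'.symm⟩

theorem finite_fiber (t : T) : (S.toFun ⁻¹' {t}).Finite :=
  (S.isCompact_preimage _ isCompact_singleton).finite (S.isDiscrete_fiber t)

theorem avg_eq_sum (f : T → ℂ) (t : T) :
    S.avg f t = ((S.finite_fiber t).toFinset.card : ℂ)⁻¹ * ∑ s ∈ (S.finite_fiber t).toFinset, f s := by
  rw [avg, finsum_mem_eq_finite_toFinset_sum _ (S.finite_fiber t),
    Set.ncard_eq_toFinset_card _ (S.finite_fiber t)]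

theorem mem_fiber {t s : T} : s ∈ (S.finite_fiber t).toFinset ↔ S.toFun s = t := by
  simp

theorem avg_add (f g : T → ℂ) (t : T) : S.avg (f + g) t = S.avg f t + S.avg g t := by
  simp only [avg_eq_sum, Pi.add_apply, Finset.sum_add_distrib, mul_add]

theorem avg_smul (c : ℂ) (f : T → ℂ) (t : T) : S.avg (c • f) t = c * S.avg f t := by
  simp only [avg_eq_sum, Pi.smul_apply, smul_eq_mul, ← Finset.mul_sum]
  ring

theorem norm_avg_le {f : T → ℂ} {t : T} {C : ℝ} (hC : 0 ≤ C)
    (h : ∀ s, S.toFun s = t → ‖f s‖ ≤ C) : ‖S.avg f t‖ ≤ C := by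
  rw [avg_eq_sum, norm_mul, norm_inv, Complex.norm_natCast]
  have h1 : ‖∑ s ∈ (S.finite_fiber t).toFinset, f s‖ ≤ (S.finite_fiber t).toFinset.card * C := by
    refine (norm_sum_le _ _).trans ?_
    rw [← nsmul_eq_mul]
    exact Finset.sum_le_card_nsmul _ _ _ fun s hs => h s (S.mem_fiber.mp hs)
  by_cases h0 : ((S.finite_fiber t).toFinset.card : ℝ) = 0
  · rw [h0, inv_zero, zero_mul]; exact hC
  · rw [inv_mul_le_iff₀ (lt_of_le_of_ne (Nat.cast_nonneg _) (Ne.symm h0))]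
    exact h1

theorem norm_apply_le (f : C₀(T, ℂ)) (t : T) : ‖f t‖ ≤ ‖f‖ := by
  rw [← ZeroAtInftyContinuousMap.norm_toBCF_eq_norm]
  exact f.toBCF.norm_coe_le_norm t

theorem norm_le_of_forall {f : C₀(T, ℂ)} {C : ℝ} (hC : 0 ≤ C) (h : ∀ t, ‖f t‖ ≤ C) : ‖f‖ ≤ C := by
  rw [← ZeroAtInftyContinuousMap.norm_toBCF_eq_norm]
  exact (BoundedContinuousFunction.norm_le hC).mpr h

/-- The average of `|f|²` over the fibre at `t`, as a real number. -/
noncomputable def avgSq (f : T → ℂ) (t : T) : ℝ :=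
  ((S.finite_fiber t).toFinset.card : ℝ)⁻¹ * ∑ s ∈ (S.finite_fiber t).toFinset, ‖f s‖ ^ 2

theorem avgSq_nonneg (f : T → ℂ) (t : T) : 0 ≤ S.avgSq f t :=
  mul_nonneg (by positivity) (Finset.sum_nonneg fun _ _ => by positivity)

theorem tendsto_avg (f : C₀(T, ℂ)) :
    Filter.Tendsto (S.avg f) (Filter.cocompact T) (nhds 0) := by
  rw [Metric.tendsto_nhds]
  intro ε hε
  have h := (Metric.tendsto_nhds.mp f.zero_at_infty') (ε / 2) (half_pos hε)
  obtain ⟨K, hK, hKs⟩ := Filter.mem_cocompact.mp h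
  refine Filter.mem_cocompact.mpr
    ⟨S.toFun '' K, hK.image S.isLocalHomeomorph.continuous, fun t ht => ?_⟩
  show dist (S.avg f t) 0 < ε
  rw [dist_zero_right]
  refine (S.norm_avg_le (half_pos hε).le fun s hs => ?_).trans_lt (half_lt_self hε)
  have hsK : s ∈ Kᶜ := fun hs' => ht ⟨s, hs', hs⟩
  have := hKs hsK
  have h2 : dist (f s) 0 < ε / 2 := this
  rw [dist_zero_right] at h2
  exact h2.le

theorem norm_α_le (a : C₀(T, ℂ)) : ‖S.α a‖ ≤ ‖a‖ :=
  norm_le_of_forall (norm_nonneg _) fun t => norm_apply_le a (S.toFun t)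

section Continuity

variable [T2Space T] [LocallyCompactSpace T]

theorem continuous_avg {f : T → ℂ} (hf : Continuous f) : Continuous (S.avg f) := by
  have hcl : IsClosedMap S.toFun :=
    (isProperMap_iff_isCompact_preimage.mpr
      ⟨S.isLocalHomeomorph.continuous, fun K hK => S.isCompact_preimage K hK⟩).isClosedMap
  have hcov : IsCoveringMapOn S.toFun Set.univ :=
    hcl.isCoveringMapOn_of_isLocalHomeomorphOn (fun t _ => S.finite_fiber t)
      S.isLocalHomeomorph.isLocalHomeomorphOn
  rw [continuous_iff_continuousAt]
  intro t
  obtain ⟨_, U, htU, hU, _, H, hH⟩ := hcov t (Set.mem_univ t)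
  have : Finite (S.toFun ⁻¹' {t}) := S.finite_fiber t
  let _ : Fintype (S.toFun ⁻¹' {t}) := Fintype.ofFinite _
  have key : ∀ u : U, S.avg f u = (Fintype.card (S.toFun ⁻¹' {t}) : ℂ)⁻¹ *
      ∑ i : S.toFun ⁻¹' {t}, f (H.symm (u, i)) := by
    intro u
    have hinj : Function.Injective fun i : S.toFun ⁻¹' {t} => (H.symm (u, i) : T) := by
      intro i j hij
      have := H.symm.injective (Subtype.ext hij)
      exact (Prod.ext_iff.mp this).2
    have himg : (S.finite_fiber u).toFinset =
        Finset.univ.map ⟨fun i : S.toFun ⁻¹' {t} => (H.symm (u, i) : T), hinj⟩ := by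
      ext s
      rw [mem_fiber]
      simp only [Finset.mem_map, Finset.mem_univ, true_and, Function.Embedding.coeFn_mk]
      constructor
      · intro hs
        have hsU : s ∈ S.toFun ⁻¹' U := by
          show S.toFun s ∈ U
          rw [hs]; exact u.2
        refine ⟨(H ⟨s, hsU⟩).2, ?_⟩
        have : (u, (H ⟨s, hsU⟩).2) = H ⟨s, hsU⟩ := by
          refine Prod.ext (Subtype.ext ?_) rfl
          rw [hH]; exact hs.symm
        rw [this, H.symm_apply_apply]
      · rintro ⟨i, rfl⟩
        rw [← hH, H.apply_symm_apply]
    rw [avg_eq_sum, himg, Finset.card_map, Finset.sum_map, Finset.card_univ]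
    rfl
  have hcont : Continuous fun u : U => S.avg f u := by
    simp_rw [key]
    fun_prop
  exact (continuousOn_iff_continuous_domRestrict.mpr hcont).continuousAt (hU.mem_nhds htU)

/-- The transfer operator `L` on `C₀(T)`, which averages over the inverse images of points. -/
noncomputable def L : C₀(T, ℂ) →ₗ[ℂ] C₀(T, ℂ) where
  toFun f :=
    { toFun := S.avg f
      continuous_toFun := S.continuous_avg f.continuous
      zero_at_infty' := S.tendsto_avg f }
  map_add' f g := ZeroAtInftyContinuousMap.ext fun t => S.avg_add f g t
  map_smul' c f := ZeroAtInftyContinuousMap.ext fun t => S.avg_smul c f t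

theorem L_apply (f : C₀(T, ℂ)) (t : T) :
    S.L f t = ((S.toFun ⁻¹' {t}).ncard : ℂ)⁻¹ * ∑ᶠ s ∈ S.toFun ⁻¹' {t}, f s := rfl

/-- `L (α(f) g) = f L(g)`. -/
theorem L_α_mul (f g : C₀(T, ℂ)) : S.L (S.α f * g) = f * S.L g := by
  ext t
  show S.avg _ t = f t * S.avg g t
  rw [avg_eq_sum, avg_eq_sum, mul_left_comm, Finset.mul_sum _ _ (f t)]
  refine congrArg _ (Finset.sum_congr rfl fun s hs => ?_)
  show f (S.toFun s) * g s = _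
  rw [S.mem_fiber.mp hs]

theorem star_L (f : C₀(T, ℂ)) : star (S.L f) = S.L (star f) := by
  ext t
  show star (S.avg f t) = S.avg _ t
  rw [avg_eq_sum, avg_eq_sum]
  simp

theorem L_star_mul_self_apply (f : C₀(T, ℂ)) (t : T) :
    S.L (star f * f) t = (S.avgSq f t : ℂ) := by
  show S.avg _ t = _
  rw [avg_eq_sum, avgSq]
  push_cast
  congr 1
  refine Finset.sum_congr rfl fun s _ => ?_
  show star (f s) * f s = _
  rw [← Complex.conj_mul']
  rfl

theorem norm_L_star_mul_apply_le (f g : C₀(T, ℂ)) (t : T) :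
    ‖S.L (star f * g) t‖ ≤ √(S.avgSq f t) * √(S.avgSq g t) := by
  show ‖S.avg _ t‖ ≤ _
  rw [avg_eq_sum, avgSq, avgSq, norm_mul, norm_inv, Complex.norm_natCast]
  rw [Real.sqrt_mul (by positivity), Real.sqrt_mul (by positivity), mul_mul_mul_comm,
    Real.mul_self_sqrt (by positivity)]
  refine mul_le_mul_of_nonneg_left ?_ (by positivity)
  refine (norm_sum_le _ _).trans ?_
  have h : ∀ s, ‖(star f * g) s‖ = ‖f s‖ * ‖g s‖ := fun s => by
    show ‖star (f s) * g s‖ = _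
    rw [norm_mul, norm_star]
  simp only [h]
  exact Real.sum_mul_le_sqrt_mul_sqrt _ _ _

/-- The seminorm `‖L(f* f)‖^{1/2}`. -/
noncomputable def semi (f : C₀(T, ℂ)) : ℝ := √‖S.L (star f * f)‖

theorem semi_nonneg (f : C₀(T, ℂ)) : 0 ≤ S.semi f := Real.sqrt_nonneg _

theorem sqrt_avgSq_le (f : C₀(T, ℂ)) (t : T) : √(S.avgSq f t) ≤ S.semi f := by
  refine Real.sqrt_le_sqrt ?_
  have := norm_apply_le (S.L (star f * f)) t
  rwa [L_star_mul_self_apply, Complex.norm_real, Real.norm_of_nonneg (S.avgSq_nonneg _ _)] at this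

theorem norm_L_star_mul_le (f g : C₀(T, ℂ)) :
    ‖S.L (star f * g)‖ ≤ S.semi f * S.semi g :=
  norm_le_of_forall (mul_nonneg (S.semi_nonneg _) (S.semi_nonneg _)) fun t =>
    (S.norm_L_star_mul_apply_le f g t).trans
      (mul_le_mul (S.sqrt_avgSq_le f t) (S.sqrt_avgSq_le g t) (Real.sqrt_nonneg _)
        (S.semi_nonneg _))

theorem semi_sq (f : C₀(T, ℂ)) : S.semi f ^ 2 = ‖S.L (star f * f)‖ :=
  Real.sq_sqrt (norm_nonneg _)

theorem semi_add_le (f g : C₀(T, ℂ)) : S.semi (f + g) ≤ S.semi f + S.semi g := by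
  refine le_of_sq_le_sq ?_ (add_nonneg (S.semi_nonneg _) (S.semi_nonneg _))
  rw [semi_sq]
  have h : S.L (star (f + g) * (f + g)) =
      S.L (star f * f) + S.L (star f * g) + (S.L (star g * f) + S.L (star g * g)) := by
    rw [star_add, add_mul, mul_add, mul_add, map_add, map_add, map_add]
  rw [h]
  refine (norm_add_le _ _).trans ((add_le_add (norm_add_le _ _) (norm_add_le _ _)).trans ?_)
  have h1 := S.norm_L_star_mul_le f f
  have h2 := S.norm_L_star_mul_le f g
  have h3 := S.norm_L_star_mul_le g f
  have h4 := S.norm_L_star_mul_le g g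
  nlinarith

theorem semi_smul (c : ℂ) (f : C₀(T, ℂ)) : S.semi (c • f) = ‖c‖ * S.semi f := by
  have h : S.L (star (c • f) * (c • f)) = (star c * c) • S.L (star f * f) := by
    rw [star_smul, smul_mul_smul_comm, map_smul]
  rw [semi, h, norm_smul, Real.sqrt_mul (norm_nonneg _), norm_mul, norm_star,
    Real.sqrt_mul_self (norm_nonneg _), semi]

theorem semi_zero : S.semi 0 = 0 := by
  have h := S.semi_smul 0 0
  rwa [zero_smul, norm_zero, zero_mul] at h

theorem semi_neg (f : C₀(T, ℂ)) : S.semi (-f) = S.semi f := by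
  have h := S.semi_smul (-1) f
  have h2 : (-1 : ℂ) • f = -f := by
    ext t
    simp
  rwa [h2, norm_neg, norm_one, one_mul] at h

theorem semi_mul_le (a f : C₀(T, ℂ)) : S.semi (a * f) ≤ ‖a‖ * S.semi f := by
  refine le_of_sq_le_sq ?_ (mul_nonneg (norm_nonneg _) (S.semi_nonneg _))
  rw [semi_sq, mul_pow]
  refine norm_le_of_forall (by positivity) fun t => ?_
  rw [L_star_mul_self_apply, Complex.norm_real, Real.norm_of_nonneg (S.avgSq_nonneg _ _)]
  have h1 : S.avgSq (a * f : C₀(T, ℂ)) t ≤ ‖a‖ ^ 2 * S.avgSq f t := by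
    rw [avgSq, avgSq, mul_left_comm, Finset.mul_sum _ _ (‖a‖ ^ 2)]
    refine mul_le_mul_of_nonneg_left (Finset.sum_le_sum fun s _ => ?_)
      (inv_nonneg.mpr (Nat.cast_nonneg _))
    show ‖a s * f s‖ ^ 2 ≤ _
    rw [norm_mul, mul_pow]
    gcongr
    exact norm_apply_le a s
  have h2 : S.avgSq f t ≤ S.semi f ^ 2 := by
    have := pow_le_pow_left₀ (Real.sqrt_nonneg _) (S.sqrt_avgSq_le f t) 2
    rwa [Real.sq_sqrt (S.avgSq_nonneg _ _)] at this
  exact h1.trans (mul_le_mul_of_nonneg_left h2 (sq_nonneg _))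

end Continuity

end ClassicalSystem

/-- A Hilbert `A`-bimodule (correspondence over `A`): a right Hilbert `A`-module with right action
`act x a = x · a` and `A`-valued inner product `ip x y = ⟨x, y⟩` (conjugate-linear in `x`), and a
left action `φ` of `A` by adjointable operators, `φ(a)* = φ(a*)`. -/
structure Correspondence (A : Type u) [NonUnitalCStarAlgebra A] where
  carrier : Type u
  [normedAddCommGroup : NormedAddCommGroup carrier]
  [normedSpace : NormedSpace ℂ carrier]
  [completeSpace : CompleteSpace carrier]
  act : carrier →L[ℂ] A →L[ℂ] carrier
  ip : carrier →L⋆[ℂ] carrier →L[ℂ] A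
  φ : A →ₙₐ[ℂ] (carrier →L[ℂ] carrier)
  act_mul : ∀ x a b, act x (a * b) = act (act x a) b
  ip_act : ∀ x y a, ip x (act y a) = ip x y * a
  star_ip : ∀ x y, star (ip x y) = ip y x
  ip_self_nonneg : ∀ x, ∃ b : A, ip x x = star b * b
  norm_sq : ∀ x, ‖x‖ ^ 2 = ‖ip x x‖
  ip_φ : ∀ a x y, ip (φ a x) y = ip x (φ (star a) y)

attribute [instance] Correspondence.normedAddCommGroup Correspondence.normedSpace
  Correspondence.completeSpace

namespace Correspondence

variable {A : Type u} [NonUnitalCStarAlgebra A] (M : Correspondence A)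

/-- The rank-one operator `Θ_{x,y} : z ↦ x · ⟨y, z⟩`. -/
noncomputable def Θ (x y : M.carrier) : M.carrier →L[ℂ] M.carrier := (M.act x).comp (M.ip y)

/-- The compact operators `𝒦(M)`: the closed linear span of the operators `Θ_{x,y}`. -/
noncomputable def compacts : Submodule ℂ (M.carrier →L[ℂ] M.carrier) :=
  (Submodule.span ℂ {k | ∃ x y, k = M.Θ x y}).topologicalClosure

theorem Θ_mem (x y : M.carrier) : M.Θ x y ∈ M.compacts :=
  Submodule.le_topologicalClosure _ (Submodule.subset_span ⟨x, y, rfl⟩)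

/-- The ideal `J(M) = φ⁻¹(𝒦(M))`. -/
def J : Set A := {a | M.φ a ∈ M.compacts}

variable {B : Type u} [NonUnitalCStarAlgebra B]

/-- `(ψ, π)` is a Toeplitz representation of `M` in `B`. -/
structure IsToeplitzRep (ψ : M.carrier →ₗ[ℂ] B) (π : A →⋆ₙₐ[ℂ] B) : Prop where
  map_act : ∀ x a, ψ (M.act x a) = ψ x * π a
  star_mul : ∀ x y, star (ψ x) * ψ y = π (M.ip x y)
  map_φ : ∀ a x, ψ (M.φ a x) = π a * ψ x

/-- `(ψ, π)` is coisometric on `K ⊆ J(M)`: `(ψ, π)⁽¹⁾ (φ(a)) = π(a)` for `a ∈ K`, where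
`Ψ = (ψ, π)⁽¹⁾` is the (unique) continuous linear map on `𝒦(M)` sending `Θ_{x,y}` to
`ψ(x) ψ(y)*`. -/
def IsCoisometricOn (K : Set A) (ψ : M.carrier →ₗ[ℂ] B) (π : A →⋆ₙₐ[ℂ] B) : Prop :=
  ∃ Ψ : M.compacts →L[ℂ] B, (∀ x y, Ψ ⟨M.Θ x y, M.Θ_mem x y⟩ = ψ x * star (ψ y)) ∧
    ∀ a ∈ K, ∃ h : M.φ a ∈ M.compacts, Ψ ⟨M.φ a, h⟩ = π a

/-- `(B, kM, kA)` is the relative Cuntz–Pimsner algebra `𝒪(K, M)`: the C⋆-algebra generated by a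
universal Toeplitz representation of `M` that is coisometric on `K`. -/
structure IsRelativeCuntzPimsner (K : Set A) (kM : M.carrier →ₗ[ℂ] B) (kA : A →⋆ₙₐ[ℂ] B) :
    Prop where
  isToeplitzRep : M.IsToeplitzRep kM kA
  isCoisometricOn : M.IsCoisometricOn K kM kA
  generates : Dense (NonUnitalStarAlgebra.adjoin ℂ (Set.range kM ∪ Set.range kA) : Set B)
  universal : ∀ (C : Type u) [NonUnitalCStarAlgebra C] (ψ : M.carrier →ₗ[ℂ] C)
    (π : A →⋆ₙₐ[ℂ] C), M.IsToeplitzRep ψ π → M.IsCoisometricOn K ψ π →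
    ∃ ρ : B →⋆ₙₐ[ℂ] C, (∀ x, ρ (kM x) = ψ x) ∧ ∀ a, ρ (kA a) = π a

/-- `(B, kM, kA)` is Pimsner's Cuntz–Pimsner algebra `𝒪(M) = 𝒪(J(M), M)`. -/
def IsCuntzPimsner (kM : M.carrier →ₗ[ℂ] B) (kA : A →⋆ₙₐ[ℂ] B) : Prop :=
  M.IsRelativeCuntzPimsner M.J kM kA

end Correspondence

section Toeplitz

variable {A : Type u} [NonUnitalCStarAlgebra A] (α : A →⋆ₙₐ[ℂ] A) (L : A →ₗ[ℂ] A)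
  {B : Type u} [NonUnitalCStarAlgebra B]

/-- `(π, V)`, with `V` in the multiplier algebra `M(B)`, is a Toeplitz-covariant representation of
`(A, α, L)` in `B`. -/
structure IsToeplitzCovariant (π : A →⋆ₙₐ[ℂ] B) (V : 𝓜(ℂ, B)) : Prop where
  nondegenerate : Dense (Submodule.span ℂ {x : B | ∃ a b, x = π a * b} : Set B)
  tc1 : ∀ a, V * (π a : 𝓜(ℂ, B)) = (π (α a) : 𝓜(ℂ, B)) * V
  tc2 : ∀ a, star V * (π a : 𝓜(ℂ, B)) * V = (π (L a) : 𝓜(ℂ, B))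

/-- `(B, i, S)` is the Toeplitz crossed product `𝒯(A, α, L)`: the C⋆-algebra generated by a
universal Toeplitz-covariant representation. Here `S.snd b` and `S.fst b` are the elements `b S`
and `S b` of `B`, so that `generates` says that `B` is generated by `i(A) ∪ i(A)S`, and `universal`
says that every Toeplitz-covariant `(π, V)` is of the form `(ρ ∘ i, ρ̄(S))`, where `ρ̄` is the
extension of `ρ` to multipliers. -/
structure IsToeplitzCrossedProduct (i : A →⋆ₙₐ[ℂ] B) (S : 𝓜(ℂ, B)) : Prop where
  isToeplitzCovariant : IsToeplitzCovariant α L i S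
  generates : Dense (NonUnitalStarAlgebra.adjoin ℂ
    (Set.range i ∪ Set.range fun a => S.snd (i a)) : Set B)
  universal : ∀ (C : Type u) [NonUnitalCStarAlgebra C] (π : A →⋆ₙₐ[ℂ] C) (V : 𝓜(ℂ, C)),
    IsToeplitzCovariant α L π V →
    ∃ ρ : B →⋆ₙₐ[ℂ] C, (∀ a, ρ (i a) = π a) ∧
      ∀ x, ρ (S.fst x) = V.fst (ρ x) ∧ ρ (S.snd x) = V.snd (ρ x)

/-- `(i(a), k)` is a redundancy: `k` is in the closed linear span of `i(A) S S* i(A)` and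
`i(a) i(b) S = k i(b) S` for all `b`. -/
def IsRedundancy (i : A →⋆ₙₐ[ℂ] B) (S : 𝓜(ℂ, B)) (a : A) (k : B) : Prop :=
  k ∈ closure (Submodule.span ℂ
      {x : B | ∃ b c, x = S.snd (i b) * (star S).fst (i c)} : Set B) ∧
    ∀ b, i a * S.snd (i b) = k * S.snd (i b)

/-- The closed linear span of `A α(A) A`. -/
def rangeIdeal : Set A :=
  closure (Submodule.span ℂ {x : A | ∃ a b c, x = a * α b * c} : Set A)

/-- The ideal `I(A, α, L)` of `𝒯(A, α, L)` generated by the elements `i(a) - k` for which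
`(i(a), k)` is a redundancy and `a` is in the closed linear span of `A α(A) A`. -/
def exelIdeal (i : A →⋆ₙₐ[ℂ] B) (S : 𝓜(ℂ, B)) : ClosedIdeal B :=
  ClosedIdeal.generated {x | ∃ a k, a ∈ rangeIdeal α ∧ IsRedundancy i S a k ∧ x = i a - k}

/-- The crossed product `A ⋊_{α,L} ℕ`: the quotient of `𝒯(A, α, L)` by `I(A, α, L)`. -/
abbrev ExelCrossedProduct (i : A →⋆ₙₐ[ℂ] B) (S : 𝓜(ℂ, B)) : Type u := (exelIdeal α i S).Quot

/-- The quotient map `Q` of `𝒯(A, α, L)` onto `A ⋊_{α,L} ℕ`. -/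
noncomputable abbrev exelQuotientMap (i : A →⋆ₙₐ[ℂ] B) (S : 𝓜(ℂ, B)) :
    B →⋆ₙₐ[ℂ] ExelCrossedProduct α i S :=
  (exelIdeal α i S).projHom

end Toeplitz

namespace ClassicalSystem

variable {T : Type u} [TopologicalSpace T]

theorem exists_star_mul_self {f : C₀(T, ℂ)} (hf : ∀ t, 0 ≤ (f t).re ∧ (f t).im = 0) :
    ∃ b : C₀(T, ℂ), f = star b * b := by
  have hc : Continuous fun t => ((√(f t).re : ℝ) : ℂ) := by
    have := f.continuous
    fun_prop
  have h0 : Filter.Tendsto (fun t => ((√(f t).re : ℝ) : ℂ)) (Filter.cocompact T) (nhds 0) := by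
    have h1 : Continuous fun z : ℂ => ((√z.re : ℝ) : ℂ) := by fun_prop
    have h2 := (h1.tendsto 0).comp f.zero_at_infty'
    simpa [Function.comp_def] using h2
  refine ⟨⟨⟨_, hc⟩, h0⟩, ZeroAtInftyContinuousMap.ext fun t => ?_⟩
  show f t = star ((√(f t).re : ℝ) : ℂ) * ((√(f t).re : ℝ) : ℂ)
  apply Complex.ext
  · simp [Real.mul_self_sqrt (hf t).1]
  · simp [(hf t).2]

variable [T2Space T] [LocallyCompactSpace T]
  (S : ClassicalSystem T)

/-- The pre-inner-product module `A_L`, for `A = C₀(T)`: a copy of `A`, with the seminorm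
`‖m‖ = ‖L(m* m)‖^{1/2}`. -/
def PreModule (_ : ClassicalSystem T) : Type u := C₀(T, ℂ)

noncomputable instance : AddCommGroup S.PreModule := inferInstanceAs (AddCommGroup C₀(T, ℂ))

noncomputable instance : Module ℂ S.PreModule := inferInstanceAs (Module ℂ C₀(T, ℂ))

noncomputable instance : SeminormedAddCommGroup S.PreModule :=
  AddGroupSeminorm.toSeminormedAddCommGroup (E := S.PreModule)
    { toFun := S.semi
      map_zero' := S.semi_zero
      add_le' := S.semi_add_le
      neg' := S.semi_neg }

noncomputable instance : NormedSpace ℂ S.PreModule where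
  norm_smul_le c f := (S.semi_smul c f).le

/-- The identity map `A → A_L`. -/
def toPre : C₀(T, ℂ) →ₗ[ℂ] S.PreModule where
  toFun f := f
  map_add' _ _ := rfl
  map_smul' _ _ := rfl

/-- The identity map `A_L → A`. -/
def ofPre : S.PreModule →ₗ[ℂ] C₀(T, ℂ) where
  toFun f := f
  map_add' _ _ := rfl
  map_smul' _ _ := rfl

theorem norm_pre (f : S.PreModule) : ‖f‖ = S.semi (S.ofPre f) := rfl

/-- The pairing `⟨m, n⟩ = L(m* n)` on `A_L`. -/
noncomputable def preIp : S.PreModule →L⋆[ℂ] S.PreModule →L[ℂ] C₀(T, ℂ) :=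
  LinearMap.mkContinuous₂
    (LinearMap.mk₂'ₛₗ (starRingEnd ℂ) (RingHom.id ℂ)
      (fun m n : S.PreModule => S.L (star (S.ofPre m) * S.ofPre n))
      (fun m m' n => by rw [map_add, star_add, add_mul, map_add])
      (fun c m n => by rw [map_smul, star_smul, smul_mul_assoc, map_smul]; rfl)
      (fun m n n' => by rw [map_add, mul_add, map_add])
      (fun c m n => by rw [map_smul, mul_smul_comm, map_smul]; rfl))
    1 (fun m n => by rw [one_mul]; exact S.norm_L_star_mul_le _ _)

/-- The right action `m · a = m α(a)` of `A` on `A_L`. -/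
noncomputable def preAct : S.PreModule →L[ℂ] C₀(T, ℂ) →L[ℂ] S.PreModule :=
  LinearMap.mkContinuous₂
    (LinearMap.mk₂ ℂ
      (fun (m : S.PreModule) (a : C₀(T, ℂ)) => S.toPre (S.ofPre m * S.α a))
      (fun m m' a => by rw [map_add, add_mul, map_add])
      (fun c m a => by rw [map_smul, smul_mul_assoc, map_smul])
      (fun m a a' => by rw [map_add, mul_add, map_add])
      (fun c m a => by rw [map_smul, mul_smul_comm, map_smul]))
    1 (fun m a => by
      rw [one_mul, mul_comm ‖m‖]
      show S.semi (S.ofPre m * S.α a) ≤ _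
      rw [mul_comm (S.ofPre m)]
      exact (S.semi_mul_le _ _).trans
        (mul_le_mul_of_nonneg_right (S.norm_α_le a) (norm_nonneg m)))

/-- Left multiplication by `a ∈ A` on `A_L`. -/
noncomputable def preLeft (a : C₀(T, ℂ)) : S.PreModule →L[ℂ] S.PreModule :=
  LinearMap.mkContinuous
    { toFun := fun m => S.toPre (a * S.ofPre m)
      map_add' := fun m n => by rw [map_add, mul_add, map_add]
      map_smul' := fun c m => by rw [map_smul, mul_smul_comm, map_smul, RingHom.id_apply] }
    ‖a‖ (fun m => S.semi_mul_le _ _)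

/-- The completion of `A_L`. -/
abbrev Module : Type u := UniformSpace.Completion S.PreModule

/-- The canonical map `q : A → M_L` (via `A_L`). -/
noncomputable def q : C₀(T, ℂ) →ₗ[ℂ] S.Module :=
  (UniformSpace.Completion.toComplL (𝕜 := ℂ) (E := S.PreModule)).toLinearMap ∘ₗ S.toPre

/-- The extension of the pairing to the completion. -/
noncomputable def ipExt : S.Module →L⋆[ℂ] S.Module →L[ℂ] C₀(T, ℂ) :=
  S.preIp.flip.fromCompletion.flip.fromCompletion

/-- The extension of the right action to the completion. -/
noncomputable def actExt : S.Module →L[ℂ] C₀(T, ℂ) →L[ℂ] S.Module :=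
  ((ContinuousLinearMap.compL ℂ C₀(T, ℂ) S.PreModule S.Module
    UniformSpace.Completion.toComplL).comp S.preAct).fromCompletion

/-- The extension of the left action to the completion. -/
noncomputable def leftExt (a : C₀(T, ℂ)) : S.Module →L[ℂ] S.Module := (S.preLeft a).completion

theorem denseRange_q : DenseRange S.q :=
  UniformSpace.Completion.denseRange_coe (α := S.PreModule)

theorem ip_q (m n : C₀(T, ℂ)) : S.ipExt (S.q m) (S.q n) = S.L (star m * n) := by
  show S.ipExt ((S.toPre m : S.PreModule) : S.Module) ((S.toPre n : S.PreModule) : S.Module) = _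
  rw [ipExt, ContinuousLinearMap.fromCompletion_apply_coe, ContinuousLinearMap.flip_apply,
    ContinuousLinearMap.fromCompletion_apply_coe, ContinuousLinearMap.flip_apply]
  rfl

theorem act_q (m a : C₀(T, ℂ)) : S.actExt (S.q m) a = S.q (m * S.α a) := by
  show S.actExt ((S.toPre m : S.PreModule) : S.Module) a = _
  rw [actExt, ContinuousLinearMap.fromCompletion_apply_coe]
  rfl

theorem left_q (a m : C₀(T, ℂ)) : S.leftExt a (S.q m) = S.q (a * m) := by
  show S.leftExt a ((S.toPre m : S.PreModule) : S.Module) = _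
  exact (S.preLeft a).completion_apply_coe (S.toPre m)

/-- The correspondence `M_L` over `C₀(T)`: the completion of `A_L`, with
`q(m) · a = q(m α(a))`, `⟨q(m), q(n)⟩ = L(m* n)` and `φ(a) q(m) = q(a m)`. -/
noncomputable def correspondence : Correspondence C₀(T, ℂ) where
  carrier := S.Module
  act := S.actExt
  ip := S.ipExt
  φ :=
    { toFun := S.leftExt
      map_smul' := fun c a => by
        refine ContinuousLinearMap.coeFn_injective (S.denseRange_q.equalizer
          (ContinuousLinearMap.continuous _) (ContinuousLinearMap.continuous _) ?_)
        funext m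
        simp [left_q, smul_mul_assoc]
      map_zero' := by
        refine ContinuousLinearMap.coeFn_injective (S.denseRange_q.equalizer
          (ContinuousLinearMap.continuous _) (ContinuousLinearMap.continuous _) ?_)
        funext m
        simp [left_q]
      map_add' := fun a b => by
        refine ContinuousLinearMap.coeFn_injective (S.denseRange_q.equalizer
          (ContinuousLinearMap.continuous _) (ContinuousLinearMap.continuous _) ?_)
        funext m
        simp [left_q, add_mul]
      map_mul' := fun a b => by
        refine ContinuousLinearMap.coeFn_injective (S.denseRange_q.equalizer
          (ContinuousLinearMap.continuous _) (ContinuousLinearMap.continuous _) ?_)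
        funext m
        simp [left_q, mul_assoc] }
  act_mul x a b := by
    induction x using S.denseRange_q.induction_on with
    | hp => exact isClosed_eq (by fun_prop) (by fun_prop)
    | ih m => simp only [act_q, map_mul, mul_assoc]
  ip_act x y a := by
    induction x, y using S.denseRange_q.induction_on₂ with
    | hp => exact isClosed_eq (by fun_prop) (by fun_prop)
    | h m n =>
      rw [act_q, ip_q, ip_q, ← mul_assoc, mul_comm _ (S.α a), L_α_mul, mul_comm]
  star_ip x y := by
    induction x, y using S.denseRange_q.induction_on₂ with
    | hp => exact isClosed_eq (by fun_prop) (by fun_prop)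
    | h m n => 
      have h : star (star m * n) = star n * m := by
        ext t
        show star (star (m t) * n t) = star (n t) * m t
        rw [star_mul, star_star]
      rw [ip_q, ip_q, star_L, h]
  ip_self_nonneg x := by
    refine exists_star_mul_self fun t => ?_
    induction x using S.denseRange_q.induction_on with
    | hp =>
      have h1 : Continuous fun x : S.Module => S.ipExt x x t :=
        ((BoundedContinuousFunction.lipschitz_eval_const t).continuous.comp
          ZeroAtInftyContinuousMap.isometry_toBCF.continuous).comp
            (by fun_prop : Continuous fun x : S.Module => S.ipExt x x)
      exact (isClosed_le continuous_const (Complex.continuous_re.comp h1)).inter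
        (isClosed_eq (Complex.continuous_im.comp h1) continuous_const)
    | ih m =>
      rw [ip_q, L_star_mul_self_apply]
      exact ⟨S.avgSq_nonneg _ _, rfl⟩
  norm_sq x := by
    induction x using S.denseRange_q.induction_on with
    | hp => exact isClosed_eq (by fun_prop) (by fun_prop)
    | ih m =>
      rw [ip_q, ← semi_sq]
      congr 1
      exact UniformSpace.Completion.norm_coe _
  ip_φ a x y := by
    show S.ipExt (S.leftExt a x) y = S.ipExt x (S.leftExt (star a) y)
    induction x, y using S.denseRange_q.induction_on₂ with
    | hp => exact isClosed_eq (by fun_prop) (by fun_prop)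
    | h m n => 
      have h : star (a * m) * n = star m * (star a * n) := by
        ext t
        show star (a t * m t) * n t = star (m t) * (star (a t) * n t)
        rw [star_mul, mul_assoc]
      rw [left_q, left_q, ip_q, ip_q, h]

/-- The ideal `K_α`: the intersection of the closed linear span of `A α(A) A` with `J(M_L)`,
for `A = C₀(T)`. -/
def K : Set C₀(T, ℂ) := rangeIdeal S.α ∩ S.correspondence.J

end ClassicalSystem

/-! Where τ is injective, the averaging operator L reduces to division by the size of a fibre. Let g
have compact support in an open set U on which τ is injective, let h be supported in U with h = 1 on
supp g, and put N(t) = |τ⁻¹(τ(t))|. For t in supp g this gives L(h* z)(τ(t)) = z(t)/N(t), so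
multiplication by g is the rank-one operator Θ with entries q(Ng) and q(h) (`φ_eq_Θ`). A partition
of unity and approximation by compactly supported functions then put all of φ(C₀(T)) in 𝒦(M_L).
Moreover f h = f α(b) h when b = 1 on τ(supp h), so A α(A) A spans a dense subspace. Thus J(M_L) and
K_α are both the whole algebra.

Toeplitz-covariant pairs (π, V) and Toeplitz representations (ψ, π) are linked by ψ(q(m)) = π(m)V.
Given V, the relation V*π(a)V = π(L(a)) makes π(m)V bounded by the norm of q(m). Given a generating
(ψ, π), V is the strict limit of ψ(q(e)) along an approximate unit e. Hence the Toeplitz algebra of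
M_L is a Toeplitz crossed product.

An element of the closed span of ψ(M)ψ(M)* is determined by its left action on ψ(M)
(`eq_of_mul_eq`), so the only k making (i(a), k) a redundancy is (ψ, i)⁽¹⁾(φ(a)). Since every a in A
is allowed, the ideal defining the crossed product is generated by all i(a) - (ψ, i)⁽¹⁾(φ(a)), and
killing these is exactly coisometricity on J(M_L) = A. The map (ψ, π)⁽¹⁾ has to be built for
representations that need not be injective; this rests on the estimate `norm_sumMulStar_le`. -/

open Filter Topology

/-! ### Universal C⋆-algebras for bounded classes of maps -/

section UniversalAlgebra

/-- The non-unital algebra homomorphism from the free algebra on two copies of `X` that sends the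
generators of the second copy to the adjoints of the images of those of the first. -/
noncomputable def freeStarLift {X : Type*} {C : Type*} [NonUnitalRing C] [StarRing C] [Module ℂ C]
    [IsScalarTower ℂ C C] [SMulCommClass ℂ C C] (g : X → C) :
    FreeNonUnitalNonAssocAlgebra ℂ (X ⊕ X) →ₙₐ[ℂ] C :=
  FreeNonUnitalNonAssocAlgebra.lift ℂ (Sum.elim g fun x => star (g x))

theorem freeStarLift_of_inl {X : Type*} {C : Type*} [NonUnitalRing C] [StarRing C] [Module ℂ C]
    [IsScalarTower ℂ C C] [SMulCommClass ℂ C C] (g : X → C) (x : X) :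
    freeStarLift g (FreeNonUnitalNonAssocAlgebra.of ℂ (Sum.inl x)) = g x :=
  FreeNonUnitalNonAssocAlgebra.lift_of_apply ℂ _ _

theorem freeStarLift_of_inr {X : Type*} {C : Type*} [NonUnitalRing C] [StarRing C] [Module ℂ C]
    [IsScalarTower ℂ C C] [SMulCommClass ℂ C C] (g : X → C) (x : X) :
    freeStarLift g (FreeNonUnitalNonAssocAlgebra.of ℂ (Sum.inr x)) = star (g x) :=
  FreeNonUnitalNonAssocAlgebra.lift_of_apply ℂ _ _

/-- The second copy of the generators supplies the adjoints, so evaluating words already yields the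
whole `*`-subalgebra although the free algebra carries no star. -/
theorem mem_range_freeStarLift {X : Type*} {C : Type*} [NonUnitalRing C] [StarRing C] [Module ℂ C]
    [IsScalarTower ℂ C C] [SMulCommClass ℂ C C] [StarModule ℂ C] (g : X → C) (c : C) :
    (∃ w, freeStarLift g w = c) ↔ c ∈ NonUnitalStarAlgebra.adjoin ℂ (Set.range g) := by
  constructor
  · rintro ⟨w, rfl⟩
    let D := NonUnitalStarAlgebra.adjoin ℂ (Set.range g)
    have hg : ∀ x, g x ∈ D := fun x => NonUnitalStarAlgebra.subset_adjoin ℂ _ ⟨x, rfl⟩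
    let g' : X → D := fun x => ⟨g x, hg x⟩
    have h : freeStarLift g =
        (NonUnitalSubalgebraClass.subtype D : D →ₙₐ[ℂ] C).comp (freeStarLift g') := by
      apply FreeNonUnitalNonAssocAlgebra.hom_ext
      rintro (x | x)
      · rw [freeStarLift_of_inl]
        exact congrArg Subtype.val (freeStarLift_of_inl g' x).symm
      · rw [freeStarLift_of_inr]
        exact congrArg Subtype.val (freeStarLift_of_inr g' x).symm
    rw [h]
    exact (freeStarLift g' w).2
  · intro hc
    have : NonUnitalAlgebra.adjoin ℂ (Set.range g ∪ star (Set.range g)) ≤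
        NonUnitalAlgHom.range (freeStarLift g) := by
      refine NonUnitalAlgebra.adjoin_le ?_
      rintro c (⟨x, rfl⟩ | ⟨x, hx⟩)
      · exact ⟨_, freeStarLift_of_inl g x⟩
      · refine ⟨_, (freeStarLift_of_inr g x).trans ?_⟩
        rw [hx, star_star]
    exact this hc

theorem map_freeStarLift {X : Type*} {B C : Type*} [NonUnitalRing B] [StarRing B] [Module ℂ B]
    [IsScalarTower ℂ B B] [SMulCommClass ℂ B B] [NonUnitalRing C] [StarRing C] [Module ℂ C]
    [IsScalarTower ℂ C C] [SMulCommClass ℂ C C] (ρ : B →⋆ₙₐ[ℂ] C) (g : X → B)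
    (w : FreeNonUnitalNonAssocAlgebra ℂ (X ⊕ X)) :
    ρ (freeStarLift g w) = freeStarLift (fun x => ρ (g x)) w := by
  have h : (ρ : B →ₙₐ[ℂ] C).comp (freeStarLift g) = freeStarLift fun x => ρ (g x) := by
    apply FreeNonUnitalNonAssocAlgebra.hom_ext
    rintro (x | x)
    · rw [freeStarLift_of_inl]
      exact congrArg ρ (freeStarLift_of_inl g x)
    · rw [freeStarLift_of_inr, ← map_star]
      exact congrArg ρ (freeStarLift_of_inr g x)
  exact DFunLike.congr_fun h w

variable {B C : Type*} [NonUnitalCStarAlgebra B] [NonUnitalCStarAlgebra C]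

theorem NonUnitalStarAlgHom.continuous (ρ : B →⋆ₙₐ[ℂ] C) : Continuous ρ :=
  AddMonoidHomClass.continuous_of_bound ρ 1 fun b => by
    rw [one_mul]; exact NonUnitalStarAlgHom.norm_apply_le ρ b

/-- A map of generators of a C⋆-algebra extends to a `*`-homomorphism if it does not increase
norms of `*`-polynomials. -/
theorem exists_starAlgHom_of_norm_le {X : Type*} (g : X → B) (f : X → C)
    (hg : Dense (NonUnitalStarAlgebra.adjoin ℂ (Set.range g) : Set B))
    (h : ∀ w, ‖freeStarLift f w‖ ≤ ‖freeStarLift g w‖) :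
    ∃ ρ : B →⋆ₙₐ[ℂ] C, ∀ x, ρ (g x) = f x := by
  have hd : DenseRange (freeStarLift g) := by
    refine hg.mono ?_
    intro b hb
    exact (mem_range_freeStarLift g b).mpr hb
  let e : FreeNonUnitalNonAssocAlgebra ℂ (X ⊕ X) →ₗ[ℂ] B := (freeStarLift g : _ →ₗ[ℂ] B)
  let r : FreeNonUnitalNonAssocAlgebra ℂ (X ⊕ X) →ₗ[ℂ] C := (freeStarLift f : _ →ₗ[ℂ] C)
  let ρ : B →L[ℂ] C := r.extendOfNorm e
  have hρ : ∀ w, ρ (freeStarLift g w) = freeStarLift f w := fun w =>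
    LinearMap.extendOfNorm_eq (f := r) (e := e) hd ⟨1, fun w => by rw [one_mul]; exact h w⟩ w
  have hmul : ∀ a b, ρ (a * b) = ρ a * ρ b := fun a b => by
    induction a, b using hd.induction_on₂ with
    | hp => exact isClosed_eq (by fun_prop) (by fun_prop)
    | h v w => rw [← map_mul, hρ, hρ, hρ, map_mul]
  have hstar : ∀ a, ρ (star a) = star (ρ a) := fun a => by
    induction a using hd.induction_on with
    | hp => exact isClosed_eq (by fun_prop) (by fun_prop)
    | ih w =>
      -- One word v must represent the adjoint of w under g and under f simultaneously. Working with
      -- the pair (g, f) in B × C provides it, because the range of evaluation there is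
      -- self-adjoint.
      have h1 : (freeStarLift g w, freeStarLift f w) ∈
          NonUnitalStarAlgebra.adjoin ℂ (Set.range fun x => (g x, f x)) := by
        refine (mem_range_freeStarLift _ _).mp ⟨w, ?_⟩
        refine Prod.ext ?_ ?_
        · exact map_freeStarLift (NonUnitalStarAlgHom.fst ℂ B C) (fun x => (g x, f x)) w
        · exact map_freeStarLift (NonUnitalStarAlgHom.snd ℂ B C) (fun x => (g x, f x)) w
      obtain ⟨v, hv⟩ := (mem_range_freeStarLift _ _).mpr (star_mem h1)
      have hv1 : freeStarLift g v = star (freeStarLift g w) := by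
        have := map_freeStarLift (NonUnitalStarAlgHom.fst ℂ B C) (fun x => (g x, f x)) v
        rw [hv] at this
        exact this.symm
      have hv2 : freeStarLift f v = star (freeStarLift f w) := by
        have := map_freeStarLift (NonUnitalStarAlgHom.snd ℂ B C) (fun x => (g x, f x)) v
        rw [hv] at this
        exact this.symm
      rw [← hv1, hρ, hv2, hρ]
  refine ⟨{ toFun := ρ, map_smul' := map_smul ρ, map_zero' := map_zero ρ, map_add' := map_add ρ,
            map_mul' := hmul, map_star' := hstar }, fun x => ?_⟩
  have := hρ (FreeNonUnitalNonAssocAlgebra.of ℂ (Sum.inl x))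
  rwa [freeStarLift_of_inl, freeStarLift_of_inl] at this

/-- A uniformly bounded class of maps from `X` to C⋆-algebras has a universal C⋆-algebra: it is
generated by a map `g` through which every map of the class factors, and the homomorphisms
arising in this way separate points. -/
theorem exists_universal {X : Type u} (P : ∀ (C : Type u) [NonUnitalCStarAlgebra C], (X → C) → Prop)
    (K : X → ℝ) (hK : ∀ (C : Type u) [NonUnitalCStarAlgebra C] (f : X → C), P C f →
      ∀ x, ‖f x‖ ≤ K x) :
    ∃ (B : Type u) (_ : NonUnitalCStarAlgebra B) (g : X → B),
      Dense (NonUnitalStarAlgebra.adjoin ℂ (Set.range g) : Set B) ∧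
      (∀ b : B, (∀ (C : Type u) [NonUnitalCStarAlgebra C] (f : X → C) (ρ : B →⋆ₙₐ[ℂ] C),
        P C f → (∀ x, ρ (g x) = f x) → ρ b = 0) → b = 0) ∧
      ∀ (C : Type u) [NonUnitalCStarAlgebra C] (f : X → C), P C f →
        ∃ ρ : B →⋆ₙₐ[ℂ] C, ∀ x, ρ (g x) = f x := by
  let F := FreeNonUnitalNonAssocAlgebra ℂ (X ⊕ X)
  -- The algebras C form a proper class, but the seminorms they induce on the free algebra form a
  -- set in the same universe. One representative per seminorm is enough for the product.
  let I : Type u := {p : F → ℝ // ∃ (C : Type u) (_ : NonUnitalCStarAlgebra C) (f : X → C),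
    P C f ∧ ∀ w, p w = ‖freeStarLift f w‖}
  choose D hD f hf hp using fun p : I => p.2
  have hmem : ∀ x, Memℓp (fun p => f p x) ⊤ := fun x =>
    memℓp_infty ⟨K x, by rintro _ ⟨p, rfl⟩; exact hK _ _ (hf p) x⟩
  let g₀ : X → lp D ⊤ := fun x => ⟨fun p => f p x, hmem x⟩
  let R : NonUnitalStarSubalgebra ℂ (lp D ⊤) :=
    (NonUnitalStarAlgebra.adjoin ℂ (Set.range g₀)).topologicalClosure
  have hRc : IsClosed (R : Set (lp D ⊤)) := NonUnitalStarSubalgebra.isClosed_topologicalClosure _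
  let instR : NonUnitalCStarAlgebra R := NonUnitalStarSubalgebra.nonUnitalCStarAlgebra R
  have hgR : ∀ x, g₀ x ∈ R := fun x => NonUnitalStarSubalgebra.le_topologicalClosure _
    (NonUnitalStarAlgebra.subset_adjoin ℂ _ ⟨x, rfl⟩)
  let g : X → R := fun x => ⟨g₀ x, hgR x⟩
  let ev : ∀ p : I, R →⋆ₙₐ[ℂ] D p := fun p =>
    { toFun := fun b => (b : lp D ⊤) p
      map_smul' := fun _ _ => rfl
      map_zero' := rfl
      map_add' := fun _ _ => rfl
      map_mul' := fun _ _ => rfl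
      map_star' := fun _ => rfl }
  have hdense : Dense (NonUnitalStarAlgebra.adjoin ℂ (Set.range g) : Set R) := by
    rw [Subtype.dense_iff]
    refine fun b hb => closure_mono ?_ hb
    intro b hb
    obtain ⟨w, rfl⟩ := (mem_range_freeStarLift g₀ b).mpr hb
    exact ⟨freeStarLift g w, (mem_range_freeStarLift g _).mp ⟨w, rfl⟩,
      map_freeStarLift (NonUnitalStarSubalgebraClass.subtype R) g w⟩
  refine ⟨R, instR, g, hdense, fun b hb => ?_, fun C _ k hk => ?_⟩
  · refine Subtype.ext (lp.ext (funext fun p => ?_))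
    exact hb (D p) (f p) (ev p) (hf p) fun x => rfl
  -- The map k induces the same seminorm as its chosen representative, which is a coordinate of the
  -- product; coordinate projections are contractive.
  · refine exists_starAlgHom_of_norm_le g k hdense fun w => ?_
    let p : I := ⟨fun w => ‖freeStarLift k w‖, C, inferInstance, k, hk, fun _ => rfl⟩
    have h1 : ‖freeStarLift k w‖ = ‖freeStarLift (f p) w‖ := hp p w
    have h2 : freeStarLift (f p) w = ev p (freeStarLift g w) :=
      (map_freeStarLift (ev p) g w).symm
    rw [h1, h2]
    exact NonUnitalStarAlgHom.norm_apply_le (ev p) _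

end UniversalAlgebra

/-! ### Pointwise limits of bounded nets and multipliers -/

section StrictLimits

/-- An eventual uniform bound transfers the Cauchy property from the span of s to its closure, and
completeness of F then supplies the limits. -/
theorem exists_clm_of_tendsto {ι E F : Type*} [NormedAddCommGroup E] [NormedSpace ℂ E]
    [NormedAddCommGroup F] [NormedSpace ℂ F] [CompleteSpace F] {l : Filter ι} [l.NeBot]
    (f : ι → E →L[ℂ] F) {K : ℝ} (hK : ∀ᶠ i in l, ‖f i‖ ≤ K) (s : Set E)
    (hs : Dense (Submodule.span ℂ s : Set E))
    (h : ∀ x ∈ s, ∃ y, Tendsto (fun i => f i x) l (𝓝 y)) :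
    ∃ g : E →L[ℂ] F, ∀ x, Tendsto (fun i => f i x) l (𝓝 (g x)) := by
  have hspan : ∀ x ∈ Submodule.span ℂ s, ∃ y, Tendsto (fun i => f i x) l (𝓝 y) := by
    intro x hx
    induction hx using Submodule.span_induction with
    | mem x hx => exact h x hx
    | zero => exact ⟨0, by simp⟩
    | add x y _ _ hx hy =>
      obtain ⟨a, ha⟩ := hx
      obtain ⟨b, hb⟩ := hy
      exact ⟨a + b, by simpa using ha.add hb⟩
    | smul c x _ hx =>
      obtain ⟨a, ha⟩ := hx
      exact ⟨c • a, by simpa using ha.const_smul c⟩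
  have hall : ∀ x, ∃ y, Tendsto (fun i => f i x) l (𝓝 y) := by
    intro x
    have hK0 : 0 ≤ K := by
      obtain ⟨i, hi⟩ := hK.exists
      exact (norm_nonneg _).trans hi
    refine CompleteSpace.complete (f := map (fun i => f i x) l) ?_
    refine Metric.cauchy_iff.mpr ⟨inferInstance, fun ε hε => ?_⟩
    -- The radius makes K‖x - z‖ at most ε/4; dividing by K + 1 covers K = 0.
    obtain ⟨z, hz, hxz⟩ := Metric.mem_closure_iff.mp (hs x) (ε / 4 / (K + 1)) (by positivity)
    obtain ⟨y, hy⟩ := hspan z hz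
    refine ⟨Metric.ball y (ε / 2), ?_, ?_⟩
    · rw [mem_map]
      filter_upwards [hK, Metric.tendsto_nhds.mp hy (ε / 4) (by positivity)] with i h1 h2
      have h3 : ‖f i x - f i z‖ ≤ K * (ε / 4 / (K + 1)) := by
        rw [← map_sub]
        refine (le_trans ((f i).le_opNorm _) ?_)
        rw [dist_eq_norm] at hxz
        gcongr
      have h4 : K * (ε / 4 / (K + 1)) ≤ ε / 4 := by
        rw [mul_div_assoc', div_le_iff₀ (by positivity)]
        nlinarith
      rw [Set.mem_preimage, Metric.mem_ball]
      calc dist (f i x) y ≤ dist (f i x) (f i z) + dist (f i z) y := dist_triangle _ _ _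
        _ < ε / 4 + ε / 4 := by
            rw [dist_eq_norm (f i x)]
            exact add_lt_add_of_le_of_lt (h3.trans h4) h2
        _ = ε / 2 := by ring
    · intro a ha b hb
      calc dist a b ≤ dist a y + dist b y := dist_triangle_right _ _ _
        _ < ε / 2 + ε / 2 := add_lt_add ha hb
        _ = ε := by ring
  choose g hg using hall
  refine ⟨LinearMap.mkContinuous
    { toFun := g
      map_add' := fun x y => tendsto_nhds_unique (hg (x + y)) (by simpa using (hg x).add (hg y))
      map_smul' := fun c x =>
        tendsto_nhds_unique (hg (c • x)) (by simpa using (hg x).const_smul c) } K fun x => ?_,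
    fun x => hg x⟩
  refine le_of_tendsto (hg x).norm ?_
  filter_upwards [hK] with i hi
  exact (f i).le_of_opNorm_le hi x

namespace DoubleCentralizer

variable {B : Type*} [NonUnitalCStarAlgebra B]

/-- Strict limits of bounded nets are multipliers. -/
theorem exists_of_tendsto {ι : Type*} {l : Filter ι} [l.NeBot] (v : ι → B) {K : ℝ}
    (hK : ∀ᶠ i in l, ‖v i‖ ≤ K) (s t : Set B) (hs : Dense (Submodule.span ℂ s : Set B))
    (ht : Dense (Submodule.span ℂ t : Set B))
    (hl : ∀ b ∈ s, ∃ c, Tendsto (fun i => v i * b) l (𝓝 c))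
    (hr : ∀ b ∈ t, ∃ c, Tendsto (fun i => b * v i) l (𝓝 c)) :
    ∃ V : 𝓜(ℂ, B), (∀ b, Tendsto (fun i => v i * b) l (𝓝 (V.fst b))) ∧
      ∀ b, Tendsto (fun i => b * v i) l (𝓝 (V.snd b)) := by
  obtain ⟨f, hf⟩ := exists_clm_of_tendsto (l := l)
    (fun i => ContinuousLinearMap.mul ℂ B (v i)) (K := K)
    (hK.mono fun i hi => (ContinuousLinearMap.opNorm_mul_apply_le ℂ B (v i)).trans hi) s hs hl
  obtain ⟨g, hg⟩ := exists_clm_of_tendsto (l := l)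
    (fun i => (ContinuousLinearMap.mul ℂ B).flip (v i)) (K := K)
    (hK.mono fun i hi => (ContinuousLinearMap.opNorm_le_bound _ (norm_nonneg _) fun b => by
      rw [mul_comm ‖v i‖]; exact norm_mul_le b (v i)).trans hi) t ht hr
  refine ⟨⟨(f, g), fun x y => ?_⟩, hf, hg⟩
  refine tendsto_nhds_unique ((hg x).mul_const y) ?_
  simpa [mul_assoc] using (hf y).const_mul x

/-- Centrality turns d* V(y) into (d* V)y. With d the difference of the two left actions at y,
equality of the right actions gives d* d = 0. So multipliers need only be compared on one side, on a
total set. -/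
theorem eq_of_snd_eq {V W : 𝓜(ℂ, B)} (s : Set B) (hs : Dense (Submodule.span ℂ s : Set B))
    (h : ∀ b ∈ s, V.snd b = W.snd b) : V = W := by
  have hsnd : V.snd = W.snd := ContinuousLinearMap.ext_on hs h
  have hfst : V.fst = W.fst := by
    ext y
    rw [← sub_eq_zero, ← CStarRing.star_mul_self_eq_zero_iff, mul_sub, ← V.central, ← W.central,
      hsnd, sub_self]
  exact DoubleCentralizer.ext _ _ _ _ (Prod.ext hfst hsnd)

end DoubleCentralizer

end StrictLimits

/-! ### Cauchy–Schwarz and adjoints in Hilbert modules -/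

namespace Correspondence

section CauchySchwarz

variable {A : Type u} [NonUnitalCStarAlgebra A] (M : Correspondence A)

theorem ip_act_left (x y : M.carrier) (a : A) : M.ip (M.act x a) y = star a * M.ip x y := by
  rw [← M.star_ip, M.ip_act, star_mul, M.star_ip]

/-- With a = ⟨x, y⟩, expand the positive element ⟨z, z⟩ for z = x·a - ‖x‖² y and use a*⟨x, x⟩a ≤
‖x‖² a*a. What remains is ‖x‖² a*a ≤ ‖x‖⁴ ⟨y, y⟩, and norms are monotone on positive elements. -/
theorem norm_ip_le (x y : M.carrier) : ‖M.ip x y‖ ≤ ‖x‖ * ‖y‖ := by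
  let _ := CStarAlgebra.spectralOrder A
  have := CStarAlgebra.spectralOrderedRing A
  rcases eq_or_ne x 0 with rfl | hx
  · simp
  have hx0 : 0 < ‖x‖ := norm_pos_iff.mpr hx
  set a := M.ip x y with ha
  set r : ℂ := ((‖x‖ ^ 2 : ℝ) : ℂ) with hr
  have hnonneg : ∀ z, 0 ≤ M.ip z z := fun z => by
    obtain ⟨b, hb⟩ := M.ip_self_nonneg z
    rw [hb]
    exact star_mul_self_nonneg b
  have h1 : star a * M.ip x x * a ≤ (‖x‖ ^ 2 : ℝ) • (star a * a) := by
    rw [M.norm_sq]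
    exact CStarAlgebra.star_left_conjugate_le_norm_smul (hb := .of_nonneg (hnonneg x))
  have h2 : M.ip (M.act x a - r • y) (M.act x a - r • y) =
      star a * M.ip x x * a - r • (star a * a) - r • (star a * a) + r • r • M.ip y y := by
    have hyx : M.ip y x = star a := by rw [ha, M.star_ip]
    have hrr : (starRingEnd ℂ) r = r := Complex.conj_ofReal _
    simp only [map_sub, ContinuousLinearMap.map_smulₛₗ, sub_apply,
      smul_apply, M.ip_act, M.ip_act_left, hyx, ← ha, hrr, RingHom.id_apply,
      mul_smul_comm]
    abel
  have hrs : ∀ c : A, r • c = (‖x‖ ^ 2 : ℝ) • c := fun c => Complex.coe_smul _ _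
  have h3 : (‖x‖ ^ 2 : ℝ) • (star a * a) ≤ (‖x‖ ^ 2 : ℝ) • (‖x‖ ^ 2 : ℝ) • M.ip y y := by
    have h4 := hnonneg (M.act x a - r • y)
    rw [h2, hrs, hrs, hrs] at h4
    have h5 := h4.trans (add_le_add_left (sub_le_sub_right (sub_le_sub_right h1 _) _) _)
    rw [sub_self, zero_sub, neg_add_eq_sub] at h5
    exact sub_nonneg.mp h5
  have h6 := CStarAlgebra.norm_le_norm_of_nonneg_of_le
    (smul_nonneg (sq_nonneg ‖x‖) (star_mul_self_nonneg a)) h3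
  rw [norm_smul, norm_smul, norm_smul, ← M.norm_sq, CStarRing.norm_star_mul_self,
    Real.norm_of_nonneg (sq_nonneg _)] at h6
  have h7 : ‖a‖ * ‖a‖ ≤ ‖x‖ ^ 2 * ‖y‖ ^ 2 := le_of_mul_le_mul_left h6 (by positivity)
  refine le_of_sq_le_sq ?_ (by positivity)
  rw [mul_pow, sq ‖a‖]
  exact h7

/-- Apply Cauchy–Schwarz to ‖K'z‖² = ‖⟨KK'z, z⟩‖ and cancel one factor ‖K'z‖. -/
theorem norm_le_of_adjoint {K K' : M.carrier →L[ℂ] M.carrier}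
    (h : ∀ x y, M.ip (K x) y = M.ip x (K' y)) : ‖K'‖ ≤ ‖K‖ := by
  refine ContinuousLinearMap.opNorm_le_bound _ (norm_nonneg _) fun z => ?_
  have h1 : ‖K' z‖ ^ 2 ≤ ‖K‖ * ‖K' z‖ * ‖z‖ := by
    rw [M.norm_sq, ← h]
    exact (M.norm_ip_le _ _).trans (by gcongr; exact K.le_opNorm _)
  rcases eq_or_ne ‖K' z‖ 0 with h0 | h0
  · rw [h0]; positivity
  · have : 0 < ‖K' z‖ := lt_of_le_of_ne (norm_nonneg _) (Ne.symm h0)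
    nlinarith

/-- Expanding the inner product bounds ‖x·e - x‖² by 2‖⟨x, x⟩e - ⟨x, x⟩‖ when ‖e‖ ≤ 1. An
approximate unit of A therefore also acts as one on the right of the module. -/
theorem tendsto_act {l : Filter A} {x : M.carrier} (hl : Tendsto (M.ip x x * ·) l (𝓝 (M.ip x x)))
    (hb : ∀ᶠ e in l, ‖e‖ ≤ 1) : Tendsto (M.act x ·) l (𝓝 x) := by
  rw [tendsto_iff_norm_sub_tendsto_zero]
  have h1 : Tendsto (fun e => √(2 * ‖M.ip x x * e - M.ip x x‖)) l (𝓝 0) := by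
    have := ((tendsto_iff_norm_sub_tendsto_zero.mp hl).const_mul 2).sqrt
    simpa using this
  refine squeeze_zero' (Eventually.of_forall fun e => norm_nonneg _) ?_ h1
  filter_upwards [hb] with e he
  refine Real.le_sqrt_of_sq_le ?_
  have h2 : M.ip (M.act x e - x) (M.act x e - x) =
      star e * (M.ip x x * e - M.ip x x) - (M.ip x x * e - M.ip x x) := by
    simp only [map_sub, sub_apply, M.ip_act, M.ip_act_left, mul_sub, mul_assoc]
    abel
  rw [M.norm_sq, h2, two_mul]
  refine (norm_sub_le _ _).trans (add_le_add_left ((norm_mul_le _ _).trans ?_) _)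
  rw [norm_star]
  exact mul_le_of_le_one_left (norm_nonneg _) he

end CauchySchwarz

variable {A : Type u} [NonUnitalCStarAlgebra A] {M : Correspondence A}
  {B : Type u} [NonUnitalCStarAlgebra B] {C : Type u} [NonUnitalCStarAlgebra C]

/-! ### Toeplitz representations and the induced map on compact operators -/

namespace IsToeplitzRep

variable {ψ : M.carrier →ₗ[ℂ] B} {π : A →⋆ₙₐ[ℂ] B}

theorem norm_le (h : M.IsToeplitzRep ψ π) (x : M.carrier) : ‖ψ x‖ ≤ ‖x‖ := by
  refine le_of_sq_le_sq ?_ (norm_nonneg x)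
  rw [sq, ← CStarRing.norm_star_mul_self, h.star_mul, M.norm_sq]
  exact NonUnitalStarAlgHom.norm_apply_le π _

theorem continuous (h : M.IsToeplitzRep ψ π) : Continuous ψ :=
  AddMonoidHomClass.continuous_of_bound ψ 1 fun x => by rw [one_mul]; exact h.norm_le x

theorem comp (h : M.IsToeplitzRep ψ π) (ρ : B →⋆ₙₐ[ℂ] C) :
    M.IsToeplitzRep ((ρ : B →ₗ[ℂ] C) ∘ₗ ψ) (ρ.comp π) where
  map_act x a := (congrArg ρ (h.map_act x a)).trans (map_mul ρ _ _)
  star_mul x y := by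
    have := congrArg ρ (h.star_mul x y)
    rwa [map_mul, map_star] at this
  map_φ a x := (congrArg ρ (h.map_φ a x)).trans (map_mul ρ _ _)

variable (M) in
/-- Finite sums of operators `Θ_{x,y}`. -/
noncomputable def _root_.Correspondence.sumΘ :
    (M.carrier × M.carrier →₀ ℂ) →ₗ[ℂ] M.carrier →L[ℂ] M.carrier :=
  Finsupp.linearCombination ℂ fun p => M.Θ p.1 p.2

/-- Finite sums of elements `ψ(x) ψ(y)*`. -/
noncomputable def _root_.LinearMap.sumMulStar (ψ : M.carrier →ₗ[ℂ] B) :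
    (M.carrier × M.carrier →₀ ℂ) →ₗ[ℂ] B :=
  Finsupp.linearCombination ℂ fun p => ψ p.1 * star (ψ p.2)

theorem _root_.Correspondence.sumΘ_single (p : M.carrier × M.carrier) (c : ℂ) :
    M.sumΘ (Finsupp.single p c) = c • M.Θ p.1 p.2 :=
  Finsupp.linearCombination_single ..

theorem _root_.LinearMap.sumMulStar_single (ψ : M.carrier →ₗ[ℂ] B) (p : M.carrier × M.carrier)
    (c : ℂ) : ψ.sumMulStar (Finsupp.single p c) = c • (ψ p.1 * star (ψ p.2)) :=
  Finsupp.linearCombination_single ..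

theorem mul_star_mul (h : M.IsToeplitzRep ψ π) (x y z : M.carrier) :
    ψ x * star (ψ y) * ψ z = ψ (M.Θ x y z) := by
  rw [mul_assoc, h.star_mul, ← h.map_act]
  rfl

theorem sumMulStar_mul (h : M.IsToeplitzRep ψ π) (w : M.carrier × M.carrier →₀ ℂ)
    (z : M.carrier) : ψ.sumMulStar w * ψ z = ψ (M.sumΘ w z) := by
  induction w using Finsupp.induction_linear with
  | zero => simp
  | add v w hv hw => simp only [map_add, add_mul, hv, hw, add_apply]
  | single p c =>
    rw [LinearMap.sumMulStar_single, sumΘ_single, smul_mul_assoc, h.mul_star_mul,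
      smul_apply, map_smul]

/-- The adjoint of Θ_{x,y} is Θ_{y,x}, and (ψ(x)ψ(y)*)* = ψ(y)ψ(x)*. The same K' serves both as
adjoint operator and as the left action of the adjoint element on ψ(M). -/
theorem exists_adjoint (h : M.IsToeplitzRep ψ π) (w : M.carrier × M.carrier →₀ ℂ) :
    ∃ K' : M.carrier →L[ℂ] M.carrier, (∀ x y, M.ip (M.sumΘ w x) y = M.ip x (K' y)) ∧
      ∀ z, star (ψ.sumMulStar w) * ψ z = ψ (K' z) := by
  induction w using Finsupp.induction_linear with
  | zero => exact ⟨0, by simp, by simp⟩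
  | add v w hv hw =>
    obtain ⟨K, hK, hK'⟩ := hv
    obtain ⟨L, hL, hL'⟩ := hw
    refine ⟨K + L, fun x y => ?_, fun z => ?_⟩
    · simp only [map_add, add_apply, hK, hL]
    · simp only [map_add, add_apply, star_add, add_mul, hK', hL']
  | single p c =>
    refine ⟨star c • M.Θ p.2 p.1, fun x y => ?_, fun z => ?_⟩
    · rw [sumΘ_single, smul_apply, smul_apply,
        ContinuousLinearMap.map_smulₛₗ, ContinuousLinearMap.map_smul,
        smul_apply]
      congr 1
      show M.ip (M.act p.1 (M.ip p.2 x)) y = M.ip x (M.act p.2 (M.ip p.1 y))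
      rw [M.ip_act_left, M.ip_act, M.star_ip]
    · rw [LinearMap.sumMulStar_single, star_smul, StarMul.star_mul, star_star, smul_mul_assoc,
        h.mul_star_mul, smul_apply, map_smul]

/-- On one term, rψ(x)ψ(y)* = ψ(Rx)ψ(y)*, of norm at most ‖R‖‖x‖‖y‖. The crude constant D depends on
w but not on r, which allows it to disappear when r runs through high powers. -/
theorem exists_norm_mul_sumMulStar_le (h : M.IsToeplitzRep ψ π)
    (w : M.carrier × M.carrier →₀ ℂ) :
    ∃ D : ℝ, 0 ≤ D ∧ ∀ (r : B) (R : M.carrier →L[ℂ] M.carrier), (∀ z, r * ψ z = ψ (R z)) →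
      ‖r * ψ.sumMulStar w‖ ≤ D * ‖R‖ := by
  induction w using Finsupp.induction_linear with
  | zero => exact ⟨0, le_rfl, by simp⟩
  | add v w hv hw =>
    obtain ⟨D, hD, hD'⟩ := hv
    obtain ⟨E, hE, hE'⟩ := hw
    refine ⟨D + E, add_nonneg hD hE, fun r R hr => ?_⟩
    rw [map_add, mul_add, add_mul]
    exact (norm_add_le _ _).trans (add_le_add (hD' r R hr) (hE' r R hr))
  | single p c =>
    refine ⟨‖c‖ * (‖p.1‖ * ‖p.2‖), by positivity, fun r R hr => ?_⟩
    rw [LinearMap.sumMulStar_single, mul_smul_comm, ← mul_assoc, hr, norm_smul, mul_assoc]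
    refine mul_le_mul_of_nonneg_left ((norm_mul_le _ _).trans ?_) (norm_nonneg _)
    rw [norm_star, mul_right_comm, mul_comm ‖p.1‖]
    gcongr
    · exact (h.norm_le _).trans (R.le_opNorm _)
    · exact h.norm_le _

/-- Since ψ may fail to be isometric, the norm of t = Σ c ψ(x)ψ(y)* is estimated by a power trick.
Put S = tt*, which acts on ψ(M) as KK', and κ = ‖K‖². Then ‖S‖ⁿ⁺¹ = ‖Sⁿtt*‖ ≤ Dκⁿ‖t‖ for arbitrarily
large n, which forces ‖S‖ ≤ κ, that is, ‖t‖ ≤ ‖K‖. -/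
theorem norm_sumMulStar_le (h : M.IsToeplitzRep ψ π) (w : M.carrier × M.carrier →₀ ℂ) :
    ‖ψ.sumMulStar w‖ ≤ ‖M.sumΘ w‖ := by
  obtain ⟨K', hK, hK'⟩ := h.exists_adjoint w
  set K := M.sumΘ w with hKdef
  set t := ψ.sumMulStar w with htdef
  have hle : ‖K'‖ ≤ ‖K‖ := M.norm_le_of_adjoint hK
  set S := t * star t with hS
  have hSact : ∀ z, S * ψ z = ψ ((K.comp K') z) := fun z => by
    rw [hS, mul_assoc, hK', h.sumMulStar_mul]
    rfl
  have hSsa : IsSelfAdjoint S := IsSelfAdjoint.mul_star_self t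
  set κ := ‖K‖ ^ 2 with hκ
  have hKK : ‖K.comp K'‖ ≤ κ := by
    rw [hκ, sq]
    exact (ContinuousLinearMap.opNorm_comp_le _ _).trans (by gcongr)
  have hκ0 : 0 ≤ κ := sq_nonneg _
  -- Here v is Sⁿ with n + 1 a power of 2, since the identity ‖a²‖ = ‖a‖² for self-adjoint a gives
  -- ‖Sⁿ⁺¹‖ = ‖S‖ⁿ⁺¹ by repeated squaring. The case n = 0 is avoided because v = 1 need not lie in
  -- B.
  have key : ∀ k : ℕ, ∃ n, k ≤ n ∧ ∃ (v : B) (R : M.carrier →L[ℂ] M.carrier),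
      (∀ z, v * ψ z = ψ (R z)) ∧ ‖R‖ ≤ κ ^ n ∧ IsSelfAdjoint (v * S) ∧
        ‖v * S‖ = ‖S‖ ^ (n + 1) := by
    intro k
    induction k with
    | zero =>
      refine ⟨1, zero_le_one, S, K.comp K', hSact, by simpa using hKK, ?_, ?_⟩
      · rw [isSelfAdjoint_iff, StarMul.star_mul, hSsa.star_eq]
      · have := CStarRing.norm_star_mul_self (x := S)
        rw [hSsa.star_eq] at this
        rw [this]; ring
    | succ k ih =>
      -- (vSv)S is the square of vS, so n + 1 doubles.
      obtain ⟨n, hn, v, R, hv, hR, hsa, hnorm⟩ := ih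
      refine ⟨2 * n + 1, by omega, v * S * v, R.comp ((K.comp K').comp R), fun z => ?_, ?_, ?_, ?_⟩
      · rw [mul_assoc, hv, mul_assoc, hSact, hv]
        rfl
      · calc ‖R.comp ((K.comp K').comp R)‖ ≤ ‖R‖ * (‖K.comp K'‖ * ‖R‖) :=
              (ContinuousLinearMap.opNorm_comp_le _ _).trans
                (by gcongr; exact ContinuousLinearMap.opNorm_comp_le _ _)
          _ ≤ κ ^ n * (κ * κ ^ n) := by gcongr
          _ = κ ^ (2 * n + 1) := by ring
      · rw [isSelfAdjoint_iff, mul_assoc (v * S), StarMul.star_mul, hsa.star_eq]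
      · have := CStarRing.norm_star_mul_self (x := v * S)
        rw [hsa.star_eq] at this
        rw [mul_assoc (v * S), this, hnorm]; ring
  obtain ⟨D, hD, hD'⟩ := h.exists_norm_mul_sumMulStar_le w
  have hmain : ‖S‖ ≤ κ := by
    by_contra! hlt
    have hSpos : 0 < ‖S‖ := hκ0.trans_lt hlt
    have hbound : ∀ k : ℕ, ‖S‖ ≤ D * ‖t‖ * (κ / ‖S‖) ^ k := by
      intro k
      obtain ⟨n, hn, v, R, hv, hR, -, hnorm⟩ := key k
      have h1 : ‖v * S‖ ≤ D * κ ^ n * ‖t‖ := by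
        rw [hS, ← mul_assoc]
        refine (norm_mul_le _ _).trans ?_
        rw [norm_star]
        gcongr
        exact (hD' v R hv).trans (by gcongr)
      rw [hnorm, pow_succ'] at h1
      have h2 : ‖S‖ ≤ D * ‖t‖ * (κ / ‖S‖) ^ n := by
        rw [div_pow, mul_div_assoc', le_div_iff₀ (by positivity)]
        linarith
      refine h2.trans (mul_le_mul_of_nonneg_left ?_ (by positivity))
      exact pow_le_pow_of_le_one (by positivity) ((div_le_one hSpos).mpr hlt.le) hn
    have hlim := (tendsto_pow_atTop_nhds_zero_of_lt_one (div_nonneg hκ0 hSpos.le)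
      ((div_lt_one hSpos).mpr hlt)).const_mul (D * ‖t‖)
    rw [mul_zero] at hlim
    exact absurd (ge_of_tendsto' hlim hbound) (not_le.mpr hSpos)
  refine le_of_sq_le_sq ?_ (norm_nonneg _)
  rw [sq ‖t‖, ← CStarRing.norm_self_mul_star]
  exact hmain

end IsToeplitzRep

variable (M) in
theorem mem_span_Θ_iff (k : M.carrier →L[ℂ] M.carrier) :
    k ∈ Submodule.span ℂ {k | ∃ x y, k = M.Θ x y} ↔ ∃ w, M.sumΘ w = k := by
  have : {k | ∃ x y, k = M.Θ x y} =
      Set.range fun p : M.carrier × M.carrier => M.Θ p.1 p.2 := by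
    ext k
    simp [eq_comm]
  rw [this, ← Finsupp.range_linearCombination]
  rfl

variable (M) in
theorem sumΘ_mem (w : M.carrier × M.carrier →₀ ℂ) : M.sumΘ w ∈ M.compacts :=
  Submodule.le_topologicalClosure _ ((M.mem_span_Θ_iff _).mpr ⟨w, rfl⟩)

variable (M) in
/-- `sumΘ` as a map into the compact operators. -/
noncomputable def sumΘ' : (M.carrier × M.carrier →₀ ℂ) →ₗ[ℂ] M.compacts :=
  M.sumΘ.codRestrict M.compacts M.sumΘ_mem

variable (M) in
theorem denseRange_sumΘ' : DenseRange M.sumΘ' := by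
  intro k
  have h := k.2
  rw [closure_subtype]
  refine closure_mono ?_ h
  intro k hk
  obtain ⟨w, rfl⟩ := (M.mem_span_Θ_iff k).mp hk
  exact ⟨M.sumΘ' w, ⟨w, rfl⟩, rfl⟩

namespace IsToeplitzRep

variable {ψ : M.carrier →ₗ[ℂ] B} {π : A →⋆ₙₐ[ℂ] B}

/-- The representation `(ψ, π)⁽¹⁾` of the compact operators. -/
theorem exists_compacts_map (h : M.IsToeplitzRep ψ π) :
    ∃ Ψ : M.compacts →L[ℂ] B, (∀ x y, Ψ ⟨M.Θ x y, M.Θ_mem x y⟩ = ψ x * star (ψ y)) ∧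
      (∀ k : M.compacts, Ψ k ∈ closure
        (Submodule.span ℂ {b : B | ∃ x y, b = ψ x * star (ψ y)} : Set B)) ∧
      ∀ (k : M.compacts) z, Ψ k * ψ z = ψ ((k : M.carrier →L[ℂ] M.carrier) z) := by
  have : IsBoundedSMul ℂ M.compacts :=
    @NormedSpace.toIsBoundedSMul _ _ _ _ (Submodule.normedSpace M.compacts)
  -- Both sums are indexed by formal combinations; the norm estimate shows that the value in B
  -- depends only on the operator represented.
  let Ψ : M.compacts →L[ℂ] B := ψ.sumMulStar.extendOfNorm M.sumΘ'
  have hΨ : ∀ w, Ψ (M.sumΘ' w) = ψ.sumMulStar w := fun w =>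
    LinearMap.extendOfNorm_eq M.denseRange_sumΘ'
      ⟨1, fun w => by rw [one_mul]; exact h.norm_sumMulStar_le w⟩ w
  refine ⟨Ψ, fun x y => ?_, fun k => ?_, fun k z => ?_⟩
  · have h1 := hΨ (Finsupp.single (x, y) 1)
    rw [LinearMap.sumMulStar_single, one_smul] at h1
    rw [← h1]
    congr 1
    refine Subtype.ext ?_
    exact ((M.sumΘ_single (x, y) 1).trans (one_smul _ _)).symm
  · induction k using M.denseRange_sumΘ'.induction_on with
    | hp => exact isClosed_closure.preimage Ψ.continuous
    | ih w =>
      rw [hΨ]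
      refine subset_closure ?_
      refine Submodule.span_mono ?_ (Finsupp.range_linearCombination ℂ (v := fun p :
        M.carrier × M.carrier => ψ p.1 * star (ψ p.2)) ▸ LinearMap.mem_range_self _ w)
      rintro _ ⟨p, rfl⟩
      exact ⟨p.1, p.2, rfl⟩
  · have hψ := h.continuous
    induction k using M.denseRange_sumΘ'.induction_on with
    | hp =>
      refine isClosed_eq (by fun_prop) (hψ.comp ?_)
      exact (ContinuousLinearMap.apply ℂ M.carrier z).continuous.comp continuous_subtype_val
    | ih w =>
      rw [hΨ]
      exact h.sumMulStar_mul w z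

end IsToeplitzRep

/-- Elements of the closed span of `ψ(M) ψ(M)*` are determined by their left action on `ψ(M)`. -/
theorem eq_of_mul_eq (ψ : M.carrier →ₗ[ℂ] B) {k k' : B}
    (hk : k ∈ closure (Submodule.span ℂ {b : B | ∃ x y, b = ψ x * star (ψ y)} : Set B))
    (hk' : k' ∈ closure (Submodule.span ℂ {b : B | ∃ x y, b = ψ x * star (ψ y)} : Set B))
    (h : ∀ z, k * ψ z = k' * ψ z) : k = k' := by
  set D := (Submodule.span ℂ {b : B | ∃ x y, b = ψ x * star (ψ y)}) with hD
  have h1 : ∀ d ∈ closure (D : Set B), (k - k') * star d = 0 := by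
    intro d hd
    have hcl : IsClosed {d : B | (k - k') * star d = 0} :=
      isClosed_eq (by fun_prop) continuous_const
    refine (closure_minimal ?_ hcl) hd
    intro d hd
    show (k - k') * star d = 0
    induction hd using Submodule.span_induction with
    | mem d hd =>
      obtain ⟨x, y, rfl⟩ := hd
      rw [star_mul, star_star, ← mul_assoc, sub_mul, h, sub_self, zero_mul]
    | zero => simp
    | add a b _ _ ha hb => rw [star_add, mul_add, ha, hb, add_zero]
    | smul c a _ ha => rw [star_smul, mul_smul_comm, ha, smul_zero]
  -- k - k' annihilates the adjoints of everything in the closed span, in particular those of k and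
  -- k' themselves.
  have h2 : (k - k') * star (k - k') = 0 := by
    rw [star_sub, mul_sub, h1 k hk, h1 k' hk', sub_zero]
  exact sub_eq_zero.mp ((CStarRing.mul_star_self_eq_zero_iff _).mp h2)

/-! ### The universal Toeplitz representation -/

variable (M) in
/-- The Toeplitz algebra of a correspondence: there is a universal Toeplitz representation. -/
theorem exists_universal_isToeplitzRep :
    ∃ (B : Type u) (_ : NonUnitalCStarAlgebra B) (ψ : M.carrier →ₗ[ℂ] B) (π : A →⋆ₙₐ[ℂ] B),
      M.IsToeplitzRep ψ π ∧
      Dense (NonUnitalStarAlgebra.adjoin ℂ (Set.range ψ ∪ Set.range π) : Set B) ∧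
      ∀ (C : Type u) [NonUnitalCStarAlgebra C] (ψ' : M.carrier →ₗ[ℂ] C) (π' : A →⋆ₙₐ[ℂ] C),
        M.IsToeplitzRep ψ' π' → ∃ ρ : B →⋆ₙₐ[ℂ] C, (∀ x, ρ (ψ x) = ψ' x) ∧ ∀ a, ρ (π a) = π' a := by
  obtain ⟨B, _, g, hgen, hsep, huniv⟩ := exists_universal (X := M.carrier ⊕ A)
    (fun C _ f => ∃ (ψ : M.carrier →ₗ[ℂ] C) (π : A →⋆ₙₐ[ℂ] C),
      M.IsToeplitzRep ψ π ∧ f = Sum.elim ψ π) (Sum.elim norm norm) (by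
    rintro C _ f ⟨ψ, π, h, rfl⟩ (x | a)
    · exact h.norm_le x
    · exact NonUnitalStarAlgHom.norm_apply_le π a)
  -- The homomorphisms onto concrete Toeplitz representations separate points, so linearity,
  -- multiplicativity and the Toeplitz relations can all be checked after applying one of them.
  have heq : ∀ b c : B, (∀ (C : Type u) [NonUnitalCStarAlgebra C] (ψ : M.carrier →ₗ[ℂ] C)
      (π : A →⋆ₙₐ[ℂ] C) (ρ : B →⋆ₙₐ[ℂ] C), M.IsToeplitzRep ψ π →
      (∀ x, ρ (g (Sum.inl x)) = ψ x) → (∀ a, ρ (g (Sum.inr a)) = π a) → ρ b = ρ c) → b = c := by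
    intro b c h
    refine sub_eq_zero.mp (hsep _ ?_)
    rintro C _ f ρ ⟨ψ, π, hψ, rfl⟩ hρ
    rw [map_sub, h C ψ π ρ hψ (fun x => hρ _) (fun a => hρ _), sub_self]
  let ψ : M.carrier →ₗ[ℂ] B :=
    { toFun := fun x => g (Sum.inl x)
      map_add' := fun x y => heq _ _ fun C _ ψ π ρ _ h1 _ => by simp only [map_add, h1]
      map_smul' := fun c x => heq _ _ fun C _ ψ π ρ _ h1 _ => by
        simp only [map_smul, h1, RingHom.id_apply] }
  let π : A →⋆ₙₐ[ℂ] B :=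
    { toFun := fun a => g (Sum.inr a)
      map_add' := fun x y => heq _ _ fun C _ ψ π ρ _ _ h2 => by simp only [map_add, h2]
      map_zero' := heq _ _ fun C _ ψ π ρ _ _ h2 => by simp only [map_zero, h2]
      map_smul' := fun c x => heq _ _ fun C _ ψ π ρ _ _ h2 => by simp only [map_smul, h2]; rfl
      map_mul' := fun x y => heq _ _ fun C _ ψ π ρ _ _ h2 => by simp only [map_mul, h2]
      map_star' := fun x => heq _ _ fun C _ ψ π ρ _ _ h2 => by simp only [map_star, h2] }
  have hψ : ∀ x, ψ x = g (Sum.inl x) := fun _ => rfl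
  have hπ : ∀ a, π a = g (Sum.inr a) := fun _ => rfl
  refine ⟨B, inferInstance, ψ, π, ⟨fun x a => ?_, fun x y => ?_, fun a x => ?_⟩, ?_, ?_⟩
  · refine heq _ _ fun C _ ψ' π' ρ h h1 h2 => ?_
    rw [map_mul, hψ, hψ, hπ, h1, h1, h2, h.map_act]
  · refine heq _ _ fun C _ ψ' π' ρ h h1 h2 => ?_
    rw [map_mul, map_star, hψ, hψ, hπ, h1, h1, h2, h.star_mul]
  · refine heq _ _ fun C _ ψ' π' ρ h h1 h2 => ?_
    rw [map_mul, hψ, hψ, hπ, h1, h1, h2, h.map_φ]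
  · have : Set.range ψ ∪ Set.range π = Set.range g := by
      ext b
      simp [hψ, hπ]
    rwa [this]
  · intro C _ ψ' π' h
    obtain ⟨ρ, hρ⟩ := huniv C (Sum.elim ψ' π') ⟨ψ', π', h, rfl⟩
    exact ⟨ρ, fun x => hρ (Sum.inl x), fun a => hρ (Sum.inr a)⟩

end Correspondence

/-! ### Compactness of the left action and density of A α(A) A -/

namespace ClassicalSystem

variable {T : Type u} [TopologicalSpace T] (S : ClassicalSystem T) in
-- The fibre through s meets U only in s, so a single term of the average survives.
theorem avg_eq_of_injOn {U : Set T} (hU : Set.InjOn S.toFun U) {f : T → ℂ}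
    (hf : ∀ t ∉ U, f t = 0) {s : T} (hs : s ∈ U) :
    S.avg f (S.toFun s) = ((S.finite_fiber (S.toFun s)).toFinset.card : ℂ)⁻¹ * f s := by
  rw [avg_eq_sum]
  congr 1
  refine Finset.sum_eq_single s (fun r hr hrs => hf r fun hrU => hrs ?_) fun h => ?_
  · exact hU hrU hs (S.mem_fiber.mp hr)
  · exact absurd (S.mem_fiber.mpr rfl) h

section Compacts

variable {T : Type u} [TopologicalSpace T] [T2Space T] [LocallyCompactSpace T]

/-- A compactly supported continuous function as an element of `C₀(T)`. -/
noncomputable def ofCompactSupport (f : T → ℂ) (hf : Continuous f) (hc : HasCompactSupport f) :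
    C₀(T, ℂ) :=
  ⟨⟨f, hf⟩, hc.is_zero_at_infty⟩

/-- The last bound keeps |f - fh| ≤ |f| away from K when h is used as a cutoff. -/
theorem exists_bump {K U : Set T} (hK : IsCompact K) (hU : IsOpen U) (hKU : K ⊆ U) :
    ∃ h : C₀(T, ℂ), HasCompactSupport h ∧ tsupport h ⊆ U ∧ (∀ t ∈ K, h t = 1) ∧
      ∀ t, ‖1 - h t‖ ≤ 1 := by
  obtain ⟨f, hf1, hfc, hfU, hf01⟩ := exists_continuousMap_one_of_isCompact_subset_isOpen hK hU hKU
  have hc : HasCompactSupport fun t => ((f t : ℝ) : ℂ) :=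
    HasCompactSupport.comp_left (g := fun r : ℝ => (r : ℂ)) hfc Complex.ofReal_zero
  refine ⟨ofCompactSupport _ (by fun_prop) hc, hc, ?_, fun t ht => ?_, fun t => ?_⟩
  · refine (closure_mono ?_).trans hfU
    intro t ht h0
    refine ht ?_
    show ((f t : ℝ) : ℂ) = 0
    rw [h0, Complex.ofReal_zero]
  · show ((f t : ℝ) : ℂ) = 1
    rw [hf1 ht]
    simp
  · show ‖1 - ((f t : ℝ) : ℂ)‖ ≤ 1
    rw [← Complex.ofReal_one, ← Complex.ofReal_sub, Complex.norm_real, Real.norm_eq_abs, abs_le]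
    have := hf01 t
    constructor <;> linarith [this.1, this.2]

theorem exists_cutoff (f : C₀(T, ℂ)) {ε : ℝ} (hε : 0 < ε) :
    ∃ h : C₀(T, ℂ), HasCompactSupport h ∧ dist f (f * h) < ε := by
  obtain ⟨K, hK, hKs⟩ := mem_cocompact.mp
    ((Metric.tendsto_nhds.mp f.zero_at_infty') (ε / 2) (half_pos hε))
  obtain ⟨h, hc, -, h1, h2⟩ := exists_bump hK isOpen_univ (Set.subset_univ K)
  refine ⟨h, hc, ?_⟩
  rw [dist_eq_norm]
  refine (norm_le_of_forall (half_pos hε).le fun t => ?_).trans_lt (half_lt_self hε)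
  have h3 : (f - f * h) t = f t * (1 - h t) := by
    show f t - f t * h t = _
    ring
  rw [h3, norm_mul]
  by_cases ht : t ∈ K
  · rw [h1 t ht, sub_self, norm_zero, mul_zero]; exact (half_pos hε).le
  · have h4 : dist (f t) 0 < ε / 2 := hKs ht
    rw [dist_zero_right] at h4
    exact (mul_le_of_le_one_right (norm_nonneg _) (h2 t)).trans h4.le

variable (S : ClassicalSystem T)

/-- For h compactly supported, choose b = 1 on the compact set τ(supp h). Then α(b) = 1 on supp h
and f h = f α(b) h, which approximates f. -/
theorem mem_rangeIdeal (f : C₀(T, ℂ)) : f ∈ rangeIdeal S.α := by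
  refine Metric.mem_closure_iff.mpr fun ε hε => ?_
  obtain ⟨h, hc, hd⟩ := exists_cutoff f hε
  obtain ⟨b, -, -, hb, -⟩ := exists_bump
    (hc.isCompact.image S.isLocalHomeomorph.continuous) isOpen_univ (Set.subset_univ _)
  refine ⟨f * h, Submodule.subset_span ⟨f, b, h, ?_⟩, hd⟩
  ext t
  show f t * h t = f t * b (S.toFun t) * h t
  by_cases ht : h t = 0
  · simp [ht]
  · rw [hb _ ⟨t, subset_tsupport _ ht, rfl⟩, mul_one]

theorem Θ_q (x y z : C₀(T, ℂ)) :
    S.correspondence.Θ (S.q x) (S.q y) (S.q z) = S.q (x * S.α (S.L (star y * z))) := by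
  show S.actExt (S.q x) (S.ipExt (S.q y) (S.q z)) = _
  rw [ip_q, act_q]

/-- Take h = 1 on supp g with support in U. For t in supp g the only contribution to L(h* z)(τ(t))
comes from t itself and equals z(t)/N(t), where N(t) is the size of the fibre through t. Setting x =
Ng undoes the factor. -/
theorem φ_eq_Θ {U : Set T} (hU : IsOpen U) (hinj : Set.InjOn S.toFun U) (g : C₀(T, ℂ))
    (hc : HasCompactSupport g) (hg : tsupport g ⊆ U) :
    ∃ x h : C₀(T, ℂ), S.correspondence.φ g = S.correspondence.Θ (S.q x) (S.q h) := by
  obtain ⟨h, -, hhU, hh1, -⟩ := exists_bump hc.isCompact hU hg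
  have hh0 : ∀ t ∉ U, h t = 0 := fun t ht => image_eq_zero_of_notMem_tsupport fun h' => ht (hhU h')
  -- On supp g this function is 1/N, so g/a is Ng. Its continuity comes from that of a, without
  -- showing that fibre sizes are locally constant. Off supp g the numerator is 0, so zeros of a
  -- there do no harm.
  let a : C₀(T, ℂ) := S.α (S.L (star h))
  have hN : ∀ t, ((S.finite_fiber (S.toFun t)).toFinset.card : ℂ) ≠ 0 := fun t =>
    Nat.cast_ne_zero.mpr (Finset.card_ne_zero_of_mem (S.mem_fiber.mpr (rfl : S.toFun t = _)))
  have ha : ∀ t ∈ tsupport g, a t = ((S.finite_fiber (S.toFun t)).toFinset.card : ℂ)⁻¹ := by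
    intro t ht
    show S.avg (star h : C₀(T, ℂ)) (S.toFun t) = _
    rw [S.avg_eq_of_injOn hinj (fun s hs => ?_) (hg ht)]
    · show _ * star (h t) = _
      rw [hh1 t ht, star_one, mul_one]
    · show star (h s) = 0
      rw [hh0 s hs, star_zero]
  have hx : Continuous fun t => g t / a t := by
    rw [continuous_iff_continuousAt]
    intro t
    by_cases ht : t ∈ tsupport g
    · refine g.continuous.continuousAt.div a.continuous.continuousAt ?_
      rw [ha t ht]
      exact inv_ne_zero (hN t)
    · have : (fun t => g t / a t) =ᶠ[𝓝 t] fun _ => 0 := by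
        filter_upwards [(isClosed_tsupport g).isOpen_compl.mem_nhds ht] with s hs
        rw [image_eq_zero_of_notMem_tsupport hs, zero_div]
      exact continuousAt_const.congr this.symm
  have hxc : HasCompactSupport fun t => g t / a t :=
    hc.mono fun t ht h0 => ht (by simp [h0])
  let x := ofCompactSupport _ hx hxc
  refine ⟨x, h, DFunLike.coe_injective (S.denseRange_q.equalizer
    (S.correspondence.φ g).continuous (S.correspondence.Θ (S.q x) (S.q h)).continuous
    (funext fun z => ?_))⟩
  show S.leftExt g (S.q z) = S.correspondence.Θ (S.q x) (S.q h) (S.q z)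
  rw [left_q, Θ_q]
  congr 1
  ext t
  show g t * z t = g t / a t * S.avg (star h * z : C₀(T, ℂ)) (S.toFun t)
  by_cases ht : t ∈ tsupport g
  · rw [S.avg_eq_of_injOn hinj (fun s hs => ?_) (hg ht), ha t ht]
    · show _ = _ * (_ * (star (h t) * z t))
      rw [hh1 t ht, star_one, one_mul]
      have := hN t
      field_simp
    · show star (h s) * z s = 0
      rw [hh0 s hs, star_zero, zero_mul]
  · rw [image_eq_zero_of_notMem_tsupport ht]; simp

theorem norm_φ_le (a : C₀(T, ℂ)) : ‖S.correspondence.φ a‖ ≤ ‖a‖ := by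
  refine ContinuousLinearMap.opNorm_le_bound _ (norm_nonneg _) fun x => ?_
  show ‖S.leftExt a x‖ ≤ ‖a‖ * ‖x‖
  induction x using S.denseRange_q.induction_on with
  | hp => exact isClosed_le (by fun_prop) (by fun_prop)
  | ih m =>
    rw [left_q]
    exact (UniformSpace.Completion.norm_coe (S.toPre (a * m))).trans_le
      ((S.semi_mul_le a m).trans_eq
        (congrArg _ (UniformSpace.Completion.norm_coe (S.toPre m)).symm))

theorem isClosed_J : IsClosed S.correspondence.J := by
  have h : Continuous fun a => S.correspondence.φ a :=
    AddMonoidHomClass.continuous_of_bound S.correspondence.φ 1 fun a => by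
      rw [one_mul]; exact S.norm_φ_le a
  exact (Submodule.isClosed_topologicalClosure _).preimage h

theorem φ_mem_compacts_of_hasCompactSupport (f : C₀(T, ℂ)) (hf : HasCompactSupport f) :
    S.correspondence.φ f ∈ S.correspondence.compacts := by
  choose e he he' using S.isLocalHomeomorph
  obtain ⟨I, -, hI⟩ := hf.isCompact.elim_nhds_subcover (fun t => (e t).source)
    fun t _ => (e t).open_source.mem_nhds (he t)
  -- Each chart source is an open set on which τ is injective, so `φ_eq_Θ` applies to each piece of
  -- a subordinate partition of unity.
  have hcov : tsupport f ⊆ ⋃ i : Fin I.card, (e (I.equivFin.symm i)).source := by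
    intro t ht
    obtain ⟨s, hs, hts⟩ := Set.mem_iUnion₂.mp (hI ht)
    refine Set.mem_iUnion.mpr ⟨I.equivFin ⟨s, hs⟩, ?_⟩
    rwa [Equiv.symm_apply_apply]
  obtain ⟨ρ, hρU, hρ1, -, hρc⟩ := exists_continuous_sum_one_of_isOpen_isCompact
    (fun i => (e (I.equivFin.symm i)).open_source) hf.isCompact hcov
  have hc : ∀ i, HasCompactSupport fun t => ((ρ i t : ℝ) : ℂ) := fun i =>
    (hρc i).comp_left (g := fun r : ℝ => (r : ℂ)) Complex.ofReal_zero
  let r : Fin I.card → C₀(T, ℂ) := fun i => ofCompactSupport _ (by fun_prop) (hc i)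
  have hsum : f = ∑ i, r i * f := by
    rw [← Finset.sum_mul]
    ext t
    have h1 : (∑ i, r i) t = ((∑ i, ρ i t : ℝ) : ℂ) := by
      let ev : C₀(T, ℂ) →+ ℂ := ⟨⟨fun f => f t, rfl⟩, fun _ _ => rfl⟩
      rw [Complex.ofReal_sum]
      exact map_sum ev r _
    show f t = (∑ i, r i) t * f t
    by_cases ht : t ∈ tsupport f
    · have h2 := hρ1 ht
      simp only [Finset.sum_apply, Pi.one_apply] at h2
      rw [h1, h2, Complex.ofReal_one, one_mul]
    · rw [image_eq_zero_of_notMem_tsupport ht, mul_zero]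
  rw [hsum, map_sum]
  refine Submodule.sum_mem _ fun i _ => ?_
  have hsub : Function.support (r i * f : C₀(T, ℂ)) ⊆ Function.support (ρ i) := by
    intro t ht h0
    refine ht ?_
    show ((ρ i t : ℝ) : ℂ) * f t = 0
    rw [h0, Complex.ofReal_zero, zero_mul]
  obtain ⟨x, y, hxy⟩ := S.φ_eq_Θ (e (I.equivFin.symm i)).open_source
    (by rw [he']; exact (e _).injOn) (r i * f) ((hρc i).mono hsub)
    ((closure_mono hsub).trans (hρU i))
  rw [hxy]
  exact S.correspondence.Θ_mem _ _

/-- `C₀(T)` acts on `M_L` by compact operators. -/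
theorem φ_mem_compacts (f : C₀(T, ℂ)) : S.correspondence.φ f ∈ S.correspondence.compacts := by
  refine S.isClosed_J.closure_subset (Metric.mem_closure_iff.mpr fun ε hε => ?_)
  obtain ⟨h, hc, hd⟩ := exists_cutoff f hε
  exact ⟨f * h, S.φ_mem_compacts_of_hasCompactSupport _ (hc.mono fun t ht h0 => ht
    (by show f t * h t = 0; rw [h0, mul_zero])), hd⟩

theorem K_eq_univ : S.K = Set.univ :=
  Set.eq_univ_of_forall fun f => ⟨S.mem_rangeIdeal f, S.φ_mem_compacts f⟩

end Compacts

end ClassicalSystem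

/-! ### Module properties of multipliers, kernels and quotients -/

namespace DoubleCentralizer

variable {B : Type*} [NonUnitalCStarAlgebra B]

/-- Centrality alone gives this: both sides agree after right multiplication by any z, in particular
by the adjoint of their difference. -/
theorem snd_mul (V : 𝓜(ℂ, B)) (x y : B) : V.snd (x * y) = x * V.snd y := by
  rw [← sub_eq_zero, ← CStarRing.mul_star_self_eq_zero_iff, sub_mul, V.central, mul_assoc,
    mul_assoc, V.central, sub_self]

theorem fst_mul (V : 𝓜(ℂ, B)) (x y : B) : V.fst (x * y) = V.fst x * y := by
  rw [← sub_eq_zero, ← CStarRing.star_mul_self_eq_zero_iff, mul_sub, ← V.central, ← mul_assoc,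
    ← mul_assoc, ← V.central, sub_self]

end DoubleCentralizer

namespace ClosedIdeal

variable {B C : Type u} [NonUnitalCStarAlgebra B] [NonUnitalCStarAlgebra C]

/-- The kernel of a `*`-homomorphism. -/
def ker (ρ : B →⋆ₙₐ[ℂ] C) : ClosedIdeal B where
  carrier := {b | ρ b = 0}
  add_mem' {a b} ha hb := by
    show ρ (a + b) = 0
    rw [map_add, ha, hb, add_zero]
  zero_mem' := map_zero ρ
  smul_mem' c b hb := by
    show ρ (c • b) = 0
    rw [map_smul, hb, smul_zero]
  mul_mem_left a b hb := by
    show ρ (a * b) = 0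
    rw [map_mul, hb, mul_zero]
  mul_mem_right a b hb := by
    show ρ (b * a) = 0
    rw [map_mul, hb, zero_mul]
  isClosed := isClosed_eq (NonUnitalStarAlgHom.continuous ρ) continuous_const

theorem exists_lift (I : ClosedIdeal B) (ρ : B →⋆ₙₐ[ℂ] C) (h : ∀ b ∈ I.carrier, ρ b = 0) :
    ∃ σ : I.Quot →⋆ₙₐ[ℂ] C, ∀ b, σ (I.projHom b) = ρ b := by
  let σ : I.Quot →ₗ[ℂ] C := I.toSubmodule.liftQ (ρ : B →ₗ[ℂ] C) h
  have hσ : ∀ b, σ (I.proj b) = ρ b := fun b => rfl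
  refine ⟨{ toFun := σ, map_smul' := map_smul σ, map_zero' := map_zero σ, map_add' := map_add σ,
            map_mul' := fun a b => ?_, map_star' := fun a => ?_ }, hσ⟩
  · obtain ⟨a, rfl⟩ := I.proj_surjective a
    obtain ⟨b, rfl⟩ := I.proj_surjective b
    exact map_mul ρ a b
  · obtain ⟨a, rfl⟩ := I.proj_surjective a
    exact map_star ρ a

end ClosedIdeal

/-! ### Toeplitz-covariant pairs versus Toeplitz representations of M_L -/

namespace ClassicalSystem

variable {T : Type u} [TopologicalSpace T] in
theorem exists_approximateUnit : ∃ l : Filter C₀(T, ℂ), l.NeBot ∧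
    (∀ a, Tendsto (· * a) l (𝓝 a)) ∧ (∀ᶠ e in l, ‖e‖ ≤ 1) ∧ ∀ᶠ e in l, star e = e := by
  let _ := CStarAlgebra.spectralOrder C₀(T, ℂ)
  have := CStarAlgebra.spectralOrderedRing C₀(T, ℂ)
  have hu := CStarAlgebra.increasingApproximateUnit C₀(T, ℂ)
  exact ⟨_, hu.neBot, hu.tendsto_mul_right, hu.eventually_norm, hu.eventually_star_eq⟩

variable {T : Type u} [TopologicalSpace T] [T2Space T] [LocallyCompactSpace T]
  (S : ClassicalSystem T)

theorem norm_q (m : C₀(T, ℂ)) : ‖S.q m‖ = S.semi m :=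
  UniformSpace.Completion.norm_coe (S.toPre m)

theorem norm_q_le (m : C₀(T, ℂ)) : ‖S.q m‖ ≤ ‖m‖ := by
  rw [norm_q]
  refine le_of_sq_le_sq ?_ (norm_nonneg m)
  rw [semi_sq]
  refine norm_le_of_forall (by positivity) fun t => ?_
  refine S.norm_avg_le (by positivity) fun s _ => ?_
  show ‖star (m s) * m s‖ ≤ _
  rw [norm_mul, norm_star, sq]
  gcongr <;> exact norm_apply_le m s

theorem continuous_q : Continuous S.q :=
  AddMonoidHomClass.continuous_of_bound S.q 1 fun m => by rw [one_mul]; exact S.norm_q_le m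

theorem tendsto_mul_α {l : Filter C₀(T, ℂ)} (hl : ∀ a, Tendsto (· * a) l (𝓝 a))
    (hb : ∀ᶠ e in l, ‖e‖ ≤ 1) (x : S.correspondence.carrier) :
    Tendsto (S.correspondence.act x ·) l (𝓝 x) := by
  refine S.correspondence.tendsto_act ?_ hb
  simpa only [mul_comm] using hl (S.correspondence.ip x x)

variable {S} {B : Type u} [NonUnitalCStarAlgebra B]

section Covariant

variable {i : C₀(T, ℂ) →⋆ₙₐ[ℂ] B} {V : 𝓜(ℂ, B)}

/-- Formally (i(m)V)* i(n)V = V* i(m* n) V, which the second covariance relation evaluates. The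
multiplier identity is tested against arbitrary b and then against the adjoint of the difference. -/
theorem star_snd_mul_snd (h : IsToeplitzCovariant S.α S.L i V) (m n : C₀(T, ℂ)) :
    star (V.snd (i m)) * V.snd (i n) = i (S.L (star m * n)) := by
  have h1 : ∀ b, star (V.snd (i m)) * V.snd (i n) * b = i (S.L (star m * n)) * b := by
    intro b
    have h2 : (star V).fst (i (star m * n) * V.fst b) = i (S.L (star m * n)) * b :=
      DFunLike.congr_fun (congrArg (fun W : 𝓜(ℂ, B) => W.fst) (h.tc2 (star m * n))) b
    rw [← h2, map_mul i, mul_assoc, V.central, mul_assoc (i (star m)), DoubleCentralizer.fst_mul,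
      DoubleCentralizer.star_fst, ← map_star i, star_star]
  rw [← sub_eq_zero, ← CStarRing.mul_star_self_eq_zero_iff, sub_mul, h1, sub_self]

theorem fst_map_mul (h : IsToeplitzCovariant S.α S.L i V) (a : C₀(T, ℂ)) (b : B) :
    V.fst (i a * b) = V.snd (i (S.α a)) * b := by
  rw [V.central]
  exact DFunLike.congr_fun (congrArg (fun W : 𝓜(ℂ, B) => W.fst) (h.tc1 a)) b

/-- A Toeplitz-covariant representation of `(C₀(T), α, L)` gives a Toeplitz representation
of `M_L`. -/
theorem exists_isToeplitzRep (h : IsToeplitzCovariant S.α S.L i V) :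
    ∃ ψ : S.correspondence.carrier →ₗ[ℂ] B,
      (∀ m, ψ (S.q m) = V.snd (i m)) ∧ S.correspondence.IsToeplitzRep ψ i := by
  let f : C₀(T, ℂ) →ₗ[ℂ] B := (V.snd : B →ₗ[ℂ] B) ∘ₗ (i : C₀(T, ℂ) →ₗ[ℂ] B)
  have hf : ∀ m, f m = V.snd (i m) := fun _ => rfl
  -- Because ‖i(m)V‖² = ‖i(L(m* m))‖ is at most ‖q(m)‖², the map m ↦ i(m)V factors through q and
  -- extends to the completion.
  have hle : ∀ m, ‖f m‖ ≤ 1 * ‖S.q m‖ := by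
    intro m
    rw [one_mul, norm_q]
    refine le_of_sq_le_sq ?_ (S.semi_nonneg m)
    rw [sq, ← CStarRing.norm_star_mul_self, hf, star_snd_mul_snd h, semi_sq]
    exact NonUnitalStarAlgHom.norm_apply_le i _
  let ψ : S.Module →L[ℂ] B := f.extendOfNorm S.q
  have hψ : ∀ m, ψ (S.q m) = V.snd (i m) := fun m =>
    LinearMap.extendOfNorm_eq S.denseRange_q ⟨1, hle⟩ m
  refine ⟨ψ.toLinearMap, hψ, ⟨fun x a => ?_, fun x y => ?_, fun a x => ?_⟩⟩
  · show ψ (S.actExt x a) = ψ x * i a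
    induction x using S.denseRange_q.induction_on with
    | hp => exact isClosed_eq (by fun_prop) (by fun_prop)
    | ih m =>
      have h1 : V.snd (i m) * i a = V.snd (i m * i (S.α a)) :=
        DFunLike.congr_fun (congrArg (fun W : 𝓜(ℂ, B) => W.snd) (h.tc1 a)) (i m)
      rw [act_q, hψ, hψ, h1, map_mul]
  · show star (ψ x) * ψ y = i (S.ipExt x y)
    have hi := NonUnitalStarAlgHom.continuous i
    induction x, y using S.denseRange_q.induction_on₂ with
    | hp => exact isClosed_eq (by fun_prop) (hi.comp (by fun_prop))
    | h m n => rw [hψ, hψ, ip_q, star_snd_mul_snd h]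
  · show ψ (S.leftExt a x) = i a * ψ x
    induction x using S.denseRange_q.induction_on with
    | hp => exact isClosed_eq (by fun_prop) (by fun_prop)
    | ih m => rw [left_q, hψ, hψ, map_mul, DoubleCentralizer.snd_mul]

end Covariant

section Multiplier

variable {ψ : S.correspondence.carrier →ₗ[ℂ] B} {π : C₀(T, ℂ) →⋆ₙₐ[ℂ] B}

theorem ψ_q_mul_map (h : S.correspondence.IsToeplitzRep ψ π) (m a : C₀(T, ℂ)) :
    ψ (S.q m) * π a = ψ (S.q (m * S.α a)) :=
  (h.map_act (S.q m) a).symm.trans (congrArg ψ (S.act_q m a))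

theorem map_mul_ψ_q (h : S.correspondence.IsToeplitzRep ψ π) (a m : C₀(T, ℂ)) :
    π a * ψ (S.q m) = ψ (S.q (a * m)) :=
  (h.map_φ a (S.q m)).symm.trans (congrArg ψ (S.left_q a m))

theorem star_ψ_q_mul (h : S.correspondence.IsToeplitzRep ψ π) (m n : C₀(T, ℂ)) :
    star (ψ (S.q m)) * ψ (S.q n) = π (S.L (star m * n)) :=
  (h.star_mul (S.q m) (S.q n)).trans (congrArg π (S.ip_q m n))

/-- On ψ(M) and π(A) convergence comes from that of e in A. It passes to products through the
leftmost factor, to sums and scalar multiples, and then to the closure by boundedness. -/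
theorem tendsto_approximateUnit_mul (h : S.correspondence.IsToeplitzRep ψ π)
    (hgen : Dense (NonUnitalStarAlgebra.adjoin ℂ (Set.range ψ ∪ Set.range π) : Set B))
    {l : Filter C₀(T, ℂ)} [l.NeBot] (hl : ∀ a, Tendsto (· * a) l (𝓝 a))
    (hb : ∀ᶠ e in l, ‖e‖ ≤ 1) (hs : ∀ᶠ e in l, star e = e) (b : B) :
    Tendsto (fun e => π e * b) l (𝓝 b) := by
  have hπ := NonUnitalStarAlgHom.continuous π
  have hbπ : ∀ᶠ e in l, ‖ContinuousLinearMap.mul ℂ B (π e)‖ ≤ 1 := hb.mono fun e he =>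
    (ContinuousLinearMap.opNorm_mul_apply_le ℂ B (π e)).trans
      ((NonUnitalStarAlgHom.norm_apply_le π e).trans he)
  have hext : ∀ s : Set B, Dense (Submodule.span ℂ s : Set B) →
      (∀ b ∈ s, Tendsto (fun e => π e * b) l (𝓝 b)) →
      ∀ b, Tendsto (fun e => π e * b) l (𝓝 b) := by
    intro s hd h1 b
    obtain ⟨g, hg⟩ := exists_clm_of_tendsto (fun e => ContinuousLinearMap.mul ℂ B (π e)) hbπ s hd
      fun b hb => ⟨b, h1 b hb⟩
    have h2 : g = ContinuousLinearMap.id ℂ B := ContinuousLinearMap.ext_on hd fun b hb =>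
      tendsto_nhds_unique (hg b) (h1 b hb)
    have h3 := hg b
    rwa [h2] at h3
  have hψq : ∀ m, Tendsto (fun e => π e * ψ (S.q m)) l (𝓝 (ψ (S.q m))) := by
    intro m
    simp only [map_mul_ψ_q h]
    exact ((h.continuous.comp S.continuous_q).tendsto m).comp (hl m)
  have hψ : ∀ x, Tendsto (fun e => π e * ψ x) l (𝓝 (ψ x)) := by
    obtain ⟨g, hg⟩ := exists_clm_of_tendsto (l := l) (E := S.Module) (F := B) (K := 1)
      (fun e => (ContinuousLinearMap.mul ℂ B (π e)).comp (⟨ψ, h.continuous⟩ : S.Module →L[ℂ] B))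
      (hbπ.mono fun e he => ContinuousLinearMap.opNorm_le_bound _ zero_le_one fun x =>
        (ContinuousLinearMap.le_of_opNorm_le _ he (ψ x)).trans (by
          rw [one_mul, one_mul]; exact h.norm_le x))
      (Set.range S.q) (by
        refine S.denseRange_q.mono ?_
        exact Submodule.subset_span)
      (by
        rintro _ ⟨m, rfl⟩
        exact ⟨ψ (S.q m), hψq m⟩)
    have hgψ : ∀ x, g x = ψ x := by
      intro x
      induction x using S.denseRange_q.induction_on with
      | hp => exact isClosed_eq (by fun_prop) h.continuous
      | ih m => exact tendsto_nhds_unique (hg (S.q m)) (hψq m)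
    intro x
    exact (hg x).trans (congrArg 𝓝 (hgψ x)).le
  -- For self-adjoint e, π(e)ψ(x)* = (ψ(x)π(e))* = ψ(x·e)*, so this case needs the approximate unit
  -- to act on the right of M_L.
  have hψs : ∀ x, Tendsto (fun e => π e * star (ψ x)) l (𝓝 (star (ψ x))) := by
    intro x
    have h1 := ((h.continuous.tendsto x).comp (S.tendsto_mul_α hl hb x)).star
    refine h1.congr' ?_
    filter_upwards [hs] with e he
    show star (ψ (S.correspondence.act x e)) = _
    rw [h.map_act, star_mul, ← map_star, he]
  have hππ : ∀ a, Tendsto (fun e => π e * π a) l (𝓝 (π a)) := fun a => by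
    simp only [← map_mul]
    exact (hπ.tendsto a).comp (hl a)
  have hadj : ∀ b ∈ NonUnitalAlgebra.adjoin ℂ
      (Set.range ψ ∪ Set.range π ∪ star (Set.range ψ ∪ Set.range π)),
      Tendsto (fun e => π e * b) l (𝓝 b) := by
    intro b hb
    induction hb using NonUnitalAlgebra.adjoin_induction with
    | mem b hb =>
      rcases hb with (⟨x, rfl⟩ | ⟨a, rfl⟩) | (⟨x, hx⟩ | ⟨a, ha⟩)
      · exact hψ x
      · exact hππ a
      · have := hψs x
        rwa [hx, star_star] at this
      · have := hππ (star a)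
        rwa [map_star, ha, star_star] at this
    | add x y _ _ hx hy => simpa only [mul_add] using hx.add hy
    | zero => simp
    | mul x y _ _ hx hy => simpa only [mul_assoc] using hx.mul_const y
    | smul c x _ hx => simpa only [mul_smul_comm] using hx.const_smul c
  exact hext _ (hgen.mono Submodule.subset_span) (fun b hb => hadj b hb) b

theorem tendsto_mul_approximateUnit (h : S.correspondence.IsToeplitzRep ψ π)
    (hgen : Dense (NonUnitalStarAlgebra.adjoin ℂ (Set.range ψ ∪ Set.range π) : Set B))
    {l : Filter C₀(T, ℂ)} [l.NeBot] (hl : ∀ a, Tendsto (· * a) l (𝓝 a))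
    (hb : ∀ᶠ e in l, ‖e‖ ≤ 1) (hs : ∀ᶠ e in l, star e = e) (b : B) :
    Tendsto (fun e => b * π e) l (𝓝 b) := by
  have h1 := (tendsto_approximateUnit_mul h hgen hl hb hs (star b)).star
  rw [star_star] at h1
  refine h1.congr' ?_
  filter_upwards [hs] with e he
  rw [star_mul, star_star, ← map_star, he]

/-- A generating Toeplitz representation of `M_L` comes from a Toeplitz-covariant
representation of `(C₀(T), α, L)`. -/
theorem exists_isToeplitzCovariant (h : S.correspondence.IsToeplitzRep ψ π)
    (hgen : Dense (NonUnitalStarAlgebra.adjoin ℂ (Set.range ψ ∪ Set.range π) : Set B)) :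
    ∃ V : 𝓜(ℂ, B), IsToeplitzCovariant S.α S.L π V ∧ ∀ m, V.snd (π m) = ψ (S.q m) := by
  obtain ⟨l, _, hl, hb, hs⟩ := exists_approximateUnit (T := T)
  have hnd := tendsto_approximateUnit_mul h hgen hl hb hs
  have hnd' := tendsto_mul_approximateUnit h hgen hl hb hs
  have hds : Dense (Submodule.span ℂ {x : B | ∃ a b, x = π a * b} : Set B) := fun b =>
    mem_closure_of_tendsto (hnd b) (Eventually.of_forall fun e =>
      Submodule.subset_span ⟨e, b, rfl⟩)
  have hdt : Dense (Submodule.span ℂ {x : B | ∃ b a, x = b * π a} : Set B) := fun b =>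
    mem_closure_of_tendsto (hnd' b) (Eventually.of_forall fun e =>
      Submodule.subset_span ⟨b, e, rfl⟩)
  have hψq : Continuous fun m => ψ (S.q m) := h.continuous.comp S.continuous_q
  have hact := fun m a => ψ_q_mul_map h m a
  have hleft := fun a m => map_mul_ψ_q h a m
  -- V is obtained as the strict limit of ψ(q(e)). Left convergence uses q(e)·a = q(eα(a)), and
  -- right convergence uses φ(a)q(e) = q(ae).
  have hL : ∀ a b, Tendsto (fun e => ψ (S.q e) * (π a * b)) l (𝓝 (ψ (S.q (S.α a)) * b)) := by
    intro a b
    simp only [← mul_assoc, hact]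
    exact ((hψq.tendsto _).comp (hl (S.α a))).mul_const b
  have hR : ∀ b a, Tendsto (fun e => b * π a * ψ (S.q e)) l (𝓝 (b * ψ (S.q a))) := by
    intro b a
    simp only [mul_assoc, hleft]
    refine ((hψq.tendsto _).comp ?_).const_mul b
    simpa only [mul_comm] using hl a
  obtain ⟨V, hV1, hV2⟩ := DoubleCentralizer.exists_of_tendsto (l := l) (fun e => ψ (S.q e)) (K := 1)
    (hb.mono fun e he => (h.norm_le _).trans ((S.norm_q_le e).trans he)) _ _ hds hdt
    (by rintro _ ⟨a, b, rfl⟩; exact ⟨_, hL a b⟩) (by rintro _ ⟨b, a, rfl⟩; exact ⟨_, hR b a⟩)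
  have hVf : ∀ a b, V.fst (π a * b) = ψ (S.q (S.α a)) * b := fun a b =>
    tendsto_nhds_unique (hV1 _) (hL a b)
  have hVs : ∀ b a, V.snd (b * π a) = b * ψ (S.q a) := fun b a =>
    tendsto_nhds_unique (hV2 _) (hR b a)
  refine ⟨V, ⟨hds, fun a => ?_, fun a => ?_⟩, fun m => ?_⟩
  · refine DoubleCentralizer.eq_of_snd_eq _ hdt ?_
    rintro _ ⟨b, m, rfl⟩
    show V.snd (b * π m) * π a = V.snd (b * π m * π (S.α a))
    rw [hVs, mul_assoc, hact, mul_assoc, ← map_mul, hVs]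
  -- Multiplying V*π(a)V on the left by bπ(m) gives bψ(q(α(m*)))*ψ(q(a)) = bπ(L(α(m)a)), and the
  -- transfer identity L(α(m)a) = mL(a) finishes.
  · refine DoubleCentralizer.eq_of_snd_eq _ hdt ?_
    rintro _ ⟨b, m, rfl⟩
    show V.snd ((star V).snd (b * π m) * π a) = b * π m * π (S.L a)
    rw [DoubleCentralizer.star_snd, star_mul, ← map_star π, hVf, star_mul, star_star, hVs, mul_assoc,
      star_ψ_q_mul h, ← map_star S.α, star_star, L_α_mul, map_mul, mul_assoc]
  · refine tendsto_nhds_unique (hV2 (π m)) ?_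
    simp only [hleft]
    refine (hψq.tendsto _).comp ?_
    simpa only [mul_comm] using hl m

end Multiplier

end ClassicalSystem

/-! ### Existence of the Toeplitz crossed product -/

namespace ClassicalSystem

variable {T : Type u} [TopologicalSpace T] [T2Space T] [LocallyCompactSpace T]
  (S : ClassicalSystem T)

/-- The Toeplitz algebra of `M_L` is a Toeplitz crossed product `𝒯(C₀(T), α, L)`. -/
theorem exists_isToeplitzCrossedProduct :
    ∃ (B : Type u) (_ : NonUnitalCStarAlgebra B) (i : C₀(T, ℂ) →⋆ₙₐ[ℂ] B) (V : 𝓜(ℂ, B)),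
      IsToeplitzCrossedProduct S.α S.L i V := by
  obtain ⟨B, _, ψ, π, h, hgen, huniv⟩ := S.correspondence.exists_universal_isToeplitzRep
  obtain ⟨V, hV, hVψ⟩ := exists_isToeplitzCovariant h hgen
  obtain ⟨l, _, hl, hb, hs⟩ := exists_approximateUnit (T := T)
  have hnd := tendsto_approximateUnit_mul h hgen hl hb hs
  have hnd' := tendsto_mul_approximateUnit h hgen hl hb hs
  refine ⟨B, inferInstance, π, V, hV, ?_, ?_⟩
  · let D := (NonUnitalStarAlgebra.adjoin ℂ
      (Set.range π ∪ Set.range fun a => V.snd (π a))).topologicalClosure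
    have hD : IsClosed (D : Set B) := NonUnitalStarSubalgebra.isClosed_topologicalClosure _
    have hle : NonUnitalStarAlgebra.adjoin ℂ (Set.range ψ ∪ Set.range π) ≤ D := by
      refine NonUnitalStarAlgebra.adjoin_le ?_
      rintro _ (⟨x, rfl⟩ | ⟨a, rfl⟩)
      · show ψ x ∈ (D : Set B)
        induction x using S.denseRange_q.induction_on with
        | hp => exact hD.preimage h.continuous
        | ih m =>
          refine NonUnitalStarSubalgebra.le_topologicalClosure _
            (NonUnitalStarAlgebra.subset_adjoin ℂ _ (Or.inr ⟨m, hVψ m⟩))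
      · exact NonUnitalStarSubalgebra.le_topologicalClosure _
          (NonUnitalStarAlgebra.subset_adjoin ℂ _ (Or.inl ⟨a, rfl⟩))
    exact dense_closure.mp (hgen.mono hle)
  · intro C _ π' V' hV'
    obtain ⟨ψ', hψ', h'⟩ := exists_isToeplitzRep hV'
    obtain ⟨ρ, hρψ, hρπ⟩ := huniv C ψ' π' h'
    have hρ := NonUnitalStarAlgHom.continuous ρ
    have hρV : ∀ a, ρ (V.snd (π a)) = V'.snd (π' a) := fun a => by
      rw [hVψ, ← hψ']; exact hρψ _
    -- That ρ carries V to V' is checked on π(a)x and xπ(a), where V acts through the elements π(a)V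
    -- of B; the approximate unit gives all x.
    refine ⟨ρ, hρπ, fun x => ⟨?_, ?_⟩⟩
    · refine tendsto_nhds_unique (((hρ.comp V.fst.continuous).tendsto x).comp (hnd x))
        ((((V'.fst.continuous.comp hρ).tendsto x).comp (hnd x)).congr fun a => ?_)
      show V'.fst (ρ (π a * x)) = ρ (V.fst (π a * x))
      rw [fst_map_mul hV, map_mul ρ, map_mul ρ, hρπ, fst_map_mul hV', hρV]
    · refine tendsto_nhds_unique (((hρ.comp V.snd.continuous).tendsto x).comp (hnd' x))
        ((((V'.snd.continuous.comp hρ).tendsto x).comp (hnd' x)).congr fun a => ?_)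
      show V'.snd (ρ (x * π a)) = ρ (V.snd (x * π a))
      rw [DoubleCentralizer.snd_mul, map_mul ρ, map_mul ρ, hρπ, DoubleCentralizer.snd_mul, hρV]

theorem closure_span_ψ_mul_star {B : Type u} [NonUnitalCStarAlgebra B]
    {ψ : S.correspondence.carrier →ₗ[ℂ] B} (hψ : Continuous ψ) :
    closure (Submodule.span ℂ {b : B | ∃ x y, b = ψ x * star (ψ y)} : Set B) =
      closure (Submodule.span ℂ {b : B | ∃ m n, b = ψ (S.q m) * star (ψ (S.q n))} : Set B) := by
  refine subset_antisymm (closure_minimal ?_ isClosed_closure) (closure_mono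
    (Submodule.span_mono ?_))
  · let D := (Submodule.span ℂ
      {b : B | ∃ m n, b = ψ (S.q m) * star (ψ (S.q n))}).topologicalClosure
    have : Submodule.span ℂ {b : B | ∃ x y, b = ψ x * star (ψ y)} ≤ D := by
      refine Submodule.span_le.mpr ?_
      rintro _ ⟨x, y, rfl⟩
      induction x, y using S.denseRange_q.induction_on₂ with
      | hp =>
        exact (Submodule.isClosed_topologicalClosure _).preimage
          ((hψ.comp continuous_fst).mul (hψ.comp continuous_snd).star)
      | h m n => exact subset_closure (Submodule.subset_span ⟨m, n, rfl⟩)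
    exact this
  · rintro _ ⟨m, n, rfl⟩
    exact ⟨S.q m, S.q n, rfl⟩

/-! ### Redundancies and the Cuntz–Pimsner property of the quotient -/

section CrossedProduct

variable {S} {B : Type u} [NonUnitalCStarAlgebra B] {i : C₀(T, ℂ) →⋆ₙₐ[ℂ] B} {V : 𝓜(ℂ, B)}
  {ψ : S.correspondence.carrier →ₗ[ℂ] B}

/-- Redundancies are the pairs `(i(a), (ψ, i)⁽¹⁾(φ(a)))`. -/
theorem isRedundancy_iff (h : S.correspondence.IsToeplitzRep ψ i)
    (hψ : ∀ m, ψ (S.q m) = V.snd (i m)) (a : C₀(T, ℂ)) (k : B) :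
    IsRedundancy i V a k ↔
      k ∈ closure (Submodule.span ℂ {b : B | ∃ x y, b = ψ x * star (ψ y)} : Set B) ∧
        ∀ x, k * ψ x = ψ (S.correspondence.φ a x) := by
  -- i(b)V V* i(c) = ψ(q(b))ψ(q(c*))*, so the two spanning sets coincide after replacing c by its
  -- adjoint.
  have hset : {x : B | ∃ b c, x = V.snd (i b) * (star V).fst (i c)} =
      {b : B | ∃ m n, b = ψ (S.q m) * star (ψ (S.q n))} := by
    ext x
    constructor
    · rintro ⟨b, c, rfl⟩
      refine ⟨b, star c, ?_⟩
      rw [hψ, hψ, DoubleCentralizer.star_fst, map_star i]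
    · rintro ⟨m, n, rfl⟩
      refine ⟨m, star n, ?_⟩
      rw [hψ, hψ, DoubleCentralizer.star_fst, map_star i, star_star]
  rw [IsRedundancy, hset, ← S.closure_span_ψ_mul_star h.continuous]
  refine and_congr_right fun _ => ⟨fun h1 x => ?_, fun h1 b => ?_⟩
  · rw [h.map_φ]
    have hc := h.continuous
    induction x using S.denseRange_q.induction_on with
    | hp => exact isClosed_eq (continuous_const.mul hc) (continuous_const.mul hc)
    | ih m => exact (hψ m) ▸ (h1 m).symm
  · rw [← hψ]
    exact (h.map_φ a (S.q b)).symm.trans (h1 (S.q b)).symm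

/-- The ideal being divided out is generated by i(a) - (ψ, i)⁽¹⁾(φ(a)) for all a, so a homomorphism
factors through the quotient exactly when the Toeplitz representation it induces is coisometric on
J(M_L). -/
theorem isCuntzPimsner (hB : IsToeplitzCrossedProduct S.α S.L i V)
    (h : S.correspondence.IsToeplitzRep ψ i) (hψ : ∀ m, ψ (S.q m) = V.snd (i m)) :
    S.correspondence.IsCuntzPimsner (B := ExelCrossedProduct S.α i V)
      ((exelQuotientMap S.α i V : B →ₗ[ℂ] ExelCrossedProduct S.α i V) ∘ₗ ψ)
      ((exelQuotientMap S.α i V).comp i) := by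
  set Q := exelQuotientMap S.α i V with hQ
  have hQc : Continuous Q := NonUnitalStarAlgHom.continuous Q
  obtain ⟨Ψ, hΨ, hΨmem, hΨmul⟩ := h.exists_compacts_map
  have hred : ∀ a, IsRedundancy i V a (Ψ ⟨_, S.φ_mem_compacts a⟩) := fun a =>
    (isRedundancy_iff h hψ a _).mpr ⟨hΨmem _, fun x => hΨmul _ x⟩
  refine ⟨h.comp Q, ?_, ?_, ?_⟩
  · refine ⟨(⟨(Q : B →ₗ[ℂ] ExelCrossedProduct S.α i V), hQc⟩ :
      B →L[ℂ] ExelCrossedProduct S.α i V).comp Ψ, fun x y => ?_, fun a _ => ?_⟩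
    · show Q (Ψ ⟨_, _⟩) = Q (ψ x) * star (Q (ψ y))
      rw [hΨ, map_mul, map_star]
    · refine ⟨S.φ_mem_compacts a, ?_⟩
      show Q (Ψ ⟨_, _⟩) = Q (i a)
      refine (((exelIdeal S.α i V).proj_eq_proj).mpr ?_).symm
      exact fun J hJ => hJ ⟨a, _, S.mem_rangeIdeal a, hred a, rfl⟩
  · have h1 := (ClosedIdeal.proj_surjective (exelIdeal S.α i V)).denseRange.dense_image hQc
      hB.generates
    refine h1.mono ?_
    rintro _ ⟨b, hb, rfl⟩
    have h2 : NonUnitalStarAlgebra.adjoin ℂ (Set.range i ∪ Set.range fun a => V.snd (i a)) ≤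
        (NonUnitalStarAlgebra.adjoin ℂ (Set.range ((Q : B →ₗ[ℂ] ExelCrossedProduct S.α i V) ∘ₗ ψ) ∪
          Set.range (Q.comp i))).comap Q := by
      refine NonUnitalStarAlgebra.adjoin_le ?_
      rintro _ (⟨a, rfl⟩ | ⟨a, rfl⟩)
      · exact NonUnitalStarAlgebra.subset_adjoin ℂ _ (Or.inr ⟨a, rfl⟩)
      · exact NonUnitalStarAlgebra.subset_adjoin ℂ _ (Or.inl ⟨S.q a, congrArg Q (hψ a)⟩)
    exact h2 hb
  · intro C _ ψ' π' h' hco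
    -- The pair (ψ', π') need not generate C, and π' need not be nondegenerate, so it may come from
    -- no covariant pair in C. The detour through the universal Toeplitz algebra, where the
    -- representation generates, supplies the multiplier needed to use the universal property of B.
    obtain ⟨B₁, _, ψ₁, π₁, h₁, hgen₁, huniv₁⟩ := S.correspondence.exists_universal_isToeplitzRep
    obtain ⟨V₁, hV₁, hVψ₁⟩ := exists_isToeplitzCovariant h₁ hgen₁
    obtain ⟨ρ₁, hρ₁ψ, hρ₁π⟩ := huniv₁ C ψ' π' h'
    obtain ⟨ρ₂, hρ₂π, hρ₂V⟩ := hB.universal B₁ π₁ V₁ hV₁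
    let ρ : B →⋆ₙₐ[ℂ] C := ρ₁.comp ρ₂
    have hρc : Continuous ρ := NonUnitalStarAlgHom.continuous ρ
    have hρi : ∀ a, ρ (i a) = π' a := fun a => by
      show ρ₁ (ρ₂ (i a)) = _
      rw [hρ₂π, hρ₁π]
    have hρψ : ∀ x, ρ (ψ x) = ψ' x := fun x => by
      have hc := h.continuous
      have hc' := h'.continuous
      induction x using S.denseRange_q.induction_on with
      | hp => exact isClosed_eq (hρc.comp hc) hc'
      | ih m =>
        have h3 : ρ₂ (ψ (S.q m)) = ψ₁ (S.q m) := by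
          rw [hψ, (hρ₂V _).2, hρ₂π, hVψ₁]
        exact (congrArg ρ₁ h3).trans (hρ₁ψ _)
    obtain ⟨Ψ', hΨ', hco'⟩ := hco
    -- Both sides are continuous and linear, and they agree on the rank-one operators.
    have hΨΨ' : ∀ k, ρ (Ψ k) = Ψ' k := fun k => by
      induction k using S.correspondence.denseRange_sumΘ'.induction_on with
      | hp => exact isClosed_eq (hρc.comp Ψ.continuous) Ψ'.continuous
      | ih w =>
        induction w using Finsupp.induction_linear with
        | zero => simp
        | add v w hv hw => simp only [map_add, hv, hw]
        | single p c =>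
          have h4 : S.correspondence.sumΘ' (Finsupp.single p c) =
              c • ⟨_, S.correspondence.Θ_mem p.1 p.2⟩ :=
            Subtype.ext (S.correspondence.sumΘ_single p c)
          rw [h4, map_smul, map_smul, map_smul, hΨ, hΨ', map_mul, map_star, hρψ, hρψ]
    have hker : ∀ b ∈ (exelIdeal S.α i V).carrier, ρ b = 0 := by
      intro b hb
      refine hb (ClosedIdeal.ker ρ) ?_
      rintro _ ⟨a, k, -, hk, rfl⟩
      -- The redundancy leaves no choice of k: both elements lie in the closed span of ψ(M)ψ(M)* and
      -- act on ψ(M) as φ(a).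
      have hkΨ : k = Ψ ⟨_, S.φ_mem_compacts a⟩ := by
        obtain ⟨hk1, hk2⟩ := (isRedundancy_iff h hψ a k).mp hk
        exact Correspondence.eq_of_mul_eq ψ hk1 (hΨmem _) fun z => by rw [hk2, hΨmul]
      obtain ⟨_, ha⟩ := hco' a (S.φ_mem_compacts a)
      show ρ (i a - k) = 0
      rw [map_sub, hkΨ, hΨΨ', ha, hρi, sub_self]
    obtain ⟨σ, hσ⟩ := (exelIdeal S.α i V).exists_lift ρ hker
    exact ⟨σ, fun x => (hσ _).trans (hρψ x), fun a => (hσ _).trans (hρi a)⟩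

end CrossedProduct

end ClassicalSystem

theorem corollary4p2 {T : Type u} [TopologicalSpace T] [T2Space T] [LocallyCompactSpace T]
    (S : ClassicalSystem T) :
    (∀ f : C₀(T, ℂ), S.correspondence.φ f ∈ S.correspondence.compacts) ∧
    S.K = Set.univ ∧
    (∃ (B : Type u) (_ : NonUnitalCStarAlgebra B) (i : C₀(T, ℂ) →⋆ₙₐ[ℂ] B) (V : 𝓜(ℂ, B)),
      IsToeplitzCrossedProduct S.α S.L i V) ∧
    ∀ (B : Type u) [NonUnitalCStarAlgebra B] (i : C₀(T, ℂ) →⋆ₙₐ[ℂ] B) (V : 𝓜(ℂ, B)),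
      IsToeplitzCrossedProduct S.α S.L i V →
      ∃ ψ : S.correspondence.carrier →ₗ[ℂ] B,
        (∀ m : C₀(T, ℂ), ψ (S.q m) = V.snd (i m)) ∧
        S.correspondence.IsToeplitzRep ψ i ∧
        S.correspondence.IsCuntzPimsner (B := ExelCrossedProduct S.α i V)
          ((exelQuotientMap S.α i V : B →ₗ[ℂ] ExelCrossedProduct S.α i V) ∘ₗ ψ)
          ((exelQuotientMap S.α i V).comp i) := by
  refine ⟨S.φ_mem_compacts, S.K_eq_univ, S.exists_isToeplitzCrossedProduct, ?_⟩
  intro B _ i V hB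
  obtain ⟨ψ, hψ, h⟩ := ClassicalSystem.exists_isToeplitzRep hB.isToeplitzCovariant
  exact ⟨ψ, hψ, h, ClassicalSystem.isCuntzPimsner hB h hψ⟩
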